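/- Let $f=\sum_{i=0}^{8} f_i x^i\in\mathbb{Q}[x]$ be squarefree of degree $7$ or $8$, let $C\colon y^2=f(x)$ be the corresponding smooth projective hyperelliptic curve of genus $3$ over $\mathbb{Q}$, with hyperelliptic involution $\phi$ and Jacobian $J$, and let $D_\infty=2(\infty)$ if $\deg f=7$ and $D_\infty=(\infty_1)+(\infty_2)$ if $\deg f=8$. For $P\in C(\overline{\mathbb{Q}})$ put $\{P,P\}=[2(P)-D_\infty]\in J(\overline{\mathbb{Q}})$. A divisor $D$ on $C$ is in general position if it is effective and $D\ge (P)+(\phi(P))$ holds for no $P$. Let $G(x_1,z_1;x_2,z_2)=2\sum_{j=0}^{4}f_{2j}(x_1x_2)^j(z_1z_2)^{4-j}+(x_1z_2+x_2z_1)\sum_{j=0}^{3}f_{2j+1}(x_1x_2)^j(z_1z_2)^{3-j}$, $F(x,z)=\sum_{i=0}^{8} f_ix^iz^{8-i}$, and write points of $C$ as $(x:y:z)$ with $y^2=F(x,z)$ (weights $1,4,1$). Let $\kappa\colon J\to\mathbb{P}^7$ be the map with image the Kummer variety $K=J/\{\pm1\}$ that is given as follows. * $\kappa(0)=(0:\dots:0:1)$.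 * If $Q=[(P_1)+(P_2)-D_\infty]$ with $(P_1)+(P_2)$ in general position, $P_i=(x_i:y_i:z_i)$, and $(z_1x-x_1z)(z_2x-x_2z)=a_0x^2+a_1xz+a_2z^2$, then $\kappa(Q)=(0:a_0^2:a_0a_1:a_0a_2:a_1^2-a_0a_2:a_1a_2:a_2^2:\sigma_8)$, where $\sigma_8=\dfrac{2y_1y_2-G(x_1,z_1;x_2,z_2)}{(x_1z_2-x_2z_1)^2}$ if $x_1z_2\ne x_2z_1$; if $P_1=P_2=(x_1:y_1:z_1)$, then $\sigma_8=-s_0/(4y_1^2)$, where $s_0$ is the value at $(x_1,z_1;x_1,z_1)$ of the form $\big(G(x,z;x',z')^2-4F(x,z)F(x',z')\big)/(xz'-x'z)^2$. * If $Q=[D-2D_\infty]$ with $D$ of degree $4$ in general position, choose binary forms $A,B,E$ of degree $4$ with $B^2-AE=F$ such that $D$ is the greatest common divisor of the divisors of zeros of $A$ and of $y-B$ on $C$. With $A(x)=A(x,1)$ and so on, and $G(x,x')=G(x,1;x',1)$, then $\kappa(Q)=(1:\xi_2:\dots:\xi_8)$, where $$\frac{2B(x)B(x')-A(x)E(x')-A(x')E(x)-G(x,x')}{(x-x')^2}=\xi_2(xx')^2+\xi_3(x+x')xx'+\xi_4(x^2+xx'+x'^2)+\xi_5xx'+\xi_6(x+x')+\xi_7$$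 and $\xi_8=\xi_2\xi_7-\xi_3\xi_6+\xi_4\xi_5$. Let $R=(0:\sigma_2:\sigma_3:\dots:\sigma_8)\in K(\mathbb{Q})$, with $\sigma_2,\dots,\sigma_8\in\mathbb{Q}$ not all zero. Here $\kappa^{-1}(R)$ is the full preimage in $J(\overline{\mathbb{Q}})$, and $\kappa(J(\mathbb{Q}))$ is the image of the Galois-invariant classes. 1. There is an affine non-Weierstrass point $P\in C(\overline{\mathbb{Q}})$ with $\kappa^{-1}(R)=\big\{\{P,P\},-\{P,P\}\big\}$ if and only if $\sigma_2\ne0$ and $\sigma_3^2-4\sigma_2\sigma_4=0$. 2. There is a rational affine non-Weierstrass point $P\in C(\mathbb{Q})$ with $\kappa^{-1}(R)=\big\{\{P,P\},-\{P,P\}\big\}$ if and only if $R\in\kappa(J(\mathbb{Q}))$, $\sigma_2\neq 0$ and $\sigma_3^2-4\sigma_2\sigma_4=0$. -/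

import Mathlib

open Polynomial
open scoped LinearAlgebra.Projectivization

namespace HypGenusThree

section Curve

variable {k : Type*} [Field k]

/-- The `k`-points of the smooth projective curve `C : y² = F(x, z)` in the weighted projective
plane with weights `(1, 4, 1)` for `(x, y, z)`, where `F(x, z) = ∑ fᵢ xⁱ z⁸⁻ⁱ` is the
degree-`8` homogenisation of `f`. The points with `z ≠ 0` are `(x : y : 1)` with `y² = f(x)`;
the points with `z = 0` are `(1 : s : 0)` with `s² = f₈` (two points over an algebraically closed
field if `deg f = 8`, and one if `deg f = 7`). -/
inductive Point (f : k[X]) : Type _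
  | affine (x y : k) (h : y ^ 2 = f.eval x) : Point f
  | infinity (s : k) (h : s ^ 2 = f.coeff 8) : Point f

namespace Point

variable {f : k[X]}

/-- The `x`-coordinate of the representative `(x : y : 1)` or `(1 : s : 0)`. -/
def xc : Point f → k
  | affine x _ _ => x
  | infinity _ _ => 1

/-- The `y`-coordinate of the representative `(x : y : 1)` or `(1 : s : 0)`. -/
def yc : Point f → k
  | affine _ y _ => y
  | infinity s _ => s

/-- The `z`-coordinate of the representative `(x : y : 1)` or `(1 : s : 0)`. -/
def zc : Point f → k
  | affine _ _ _ => 1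
  | infinity _ _ => 0

/-- The hyperelliptic involution `φ : (x : y : z) ↦ (x : -y : z)`. -/
def invol : Point f → Point f
  | affine x y h => affine x (-y) (by rw [neg_sq, h])
  | infinity s h => infinity (-s) (by rw [neg_sq, h])

/-- The point is affine and is not a Weierstrass point. -/
def IsAffineNonWeierstrass : Point f → Prop
  | affine _ y _ => y ≠ 0
  | infinity _ _ => False

end Point

/-- The affine coordinate ring `k[x, y] / (y² - g(x))`. -/
abbrev CoordRing (g : k[X]) : Type _ := AdjoinRoot (X ^ 2 - C g : k[X][X])

/-- The ideal `(x - x₀, y - y₀)` of the coordinate ring. -/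
noncomputable def pointIdeal (g : k[X]) (x₀ y₀ : k) : Ideal (CoordRing g) :=
  Ideal.span {AdjoinRoot.of _ (X - C x₀), AdjoinRoot.root _ - AdjoinRoot.of _ (C y₀)}

/-- The order of vanishing of the function `u(x) + v(x) y` at the point `(x₀, y₀)` of the smooth
affine curve `y² = g(x)`: the largest `n` such that the function lies in the `n`-th power of the
maximal ideal of the point. Only used when `u + v y ≠ 0`, so that these `n` are bounded. -/
noncomputable def vanishOrder (g : k[X]) (x₀ y₀ : k) (u v : k[X]) : ℕ :=
  sSup {n : ℕ | AdjoinRoot.of _ u + AdjoinRoot.of _ v * AdjoinRoot.root (X ^ 2 - C g : k[X][X])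
    ∈ pointIdeal g x₀ y₀ ^ n}

/-- The order of vanishing at a point of `C` of the weighted homogeneous form `U(x, z) + V(x, z) y`
of weight `d + 4`, where `U`, `V` are binary forms of degree `d + 4` and `d`, given through their
dehomogenisations `u = U(x, 1)`, `v = V(x, 1)` with `deg u ≤ d + 4`, `deg v ≤ d`.
It is computed in the chart `z = 1` with equation `y² = f(x)` at an affine point, and in the chart
`x = 1` with equation `y² = F(1, z)` at a point at infinity. -/
noncomputable def ordForm (f : k[X]) (d : ℕ) (u v : k[X]) : Point f → ℕ
  | .affine x y _ => vanishOrder f x y u v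
  | .infinity s _ => vanishOrder (f.reflect 8) 0 s (u.reflect (d + 4)) (v.reflect d)

/-- The group of divisors on `C`. -/
abbrev Divisor (f : k[X]) : Type _ := Point f →₀ ℤ

/-- The prime divisor `(P)`. -/
noncomputable def pt {f : k[X]} (P : Point f) : Divisor f := Finsupp.single P 1

/-- The degree of a divisor. -/
noncomputable def deg (f : k[X]) : Divisor f →+ ℤ :=
  Finsupp.liftAddHom fun _ => AddMonoidHom.id ℤ

theorem deg_pt {f : k[X]} (P : Point f) : deg f (pt P) = 1 := by
  simp [deg, pt]

/-- `D` is the divisor of a nonzero rational function, i.e. of a quotient of two nonzero weighted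
homogeneous forms of the same weight. -/
def IsDivOfFunction (f : k[X]) (D : Divisor f) : Prop :=
  ∃ (d : ℕ) (u v u' v' : k[X]),
    u.natDegree ≤ d + 4 ∧ v.natDegree ≤ d ∧ u'.natDegree ≤ d + 4 ∧ v'.natDegree ≤ d ∧
    (u ≠ 0 ∨ v ≠ 0) ∧ (u' ≠ 0 ∨ v' ≠ 0) ∧
    ∀ P : Point f, D P = (ordForm f d u v P : ℤ) - (ordForm f d u' v' P : ℤ)

/-- The group of principal divisors. -/
noncomputable def principal (f : k[X]) : AddSubgroup (Divisor f) :=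
  AddSubgroup.closure {D | IsDivOfFunction f D}

/-- The divisor class group of `C`. -/
abbrev Pic (f : k[X]) : Type _ := Divisor f ⧸ principal f

/-- The class of a divisor. -/
noncomputable def cls (f : k[X]) : Divisor f →+ Pic f := QuotientAddGroup.mk' (principal f)

/-- The group of points of the Jacobian of `C` over the (algebraically closed) field `k`:
divisor classes of degree `0`. -/
noncomputable def Jac (f : k[X]) : AddSubgroup (Pic f) := (deg f).ker.map (cls f)

/-- A divisor in general position: effective, and never `D ≥ (P) + (φ(P))`. -/
def IsGeneralPosition {f : k[X]} (D : Divisor f) : Prop :=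
  0 ≤ D ∧ ∀ P : Point f, ¬ (pt P + pt P.invol ≤ D)

/-- The form `G`, for `f` with coefficients `c i`, over any commutative ring:
`G(x₁,z₁;x₂,z₂) = 2 ∑ f₂ⱼ (x₁x₂)ʲ(z₁z₂)⁴⁻ʲ + (x₁z₂ + x₂z₁) ∑ f₂ⱼ₊₁ (x₁x₂)ʲ(z₁z₂)³⁻ʲ`. -/
def formG {A : Type*} [CommRing A] (c : ℕ → A) (x₁ z₁ x₂ z₂ : A) : A :=
  2 * ∑ j ∈ Finset.range 5, c (2 * j) * (x₁ * x₂) ^ j * (z₁ * z₂) ^ (4 - j) +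
    (x₁ * z₂ + x₂ * z₁) *
      ∑ j ∈ Finset.range 4, c (2 * j + 1) * (x₁ * x₂) ^ j * (z₁ * z₂) ^ (3 - j)

/-- The form `F(x, z) = ∑ fᵢ xⁱ z⁸⁻ⁱ`, for `f` with coefficients `c i`. -/
def formF {A : Type*} [CommRing A] (c : ℕ → A) (x z : A) : A :=
  ∑ i ∈ Finset.range 9, c i * x ^ i * z ^ (8 - i)

/-- For a point `P = (x : y : z)`, the value `s₀` at `(P, P)` of the form
`(G(x₁,z₁;x₂,z₂)² - 4 F(x₁,z₁) F(x₂,z₂)) / (x₁z₂ - x₂z₁)²`. It is read off at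
`(x₁ : z₁) = (x + t : z)` (or `(x : z + t)` for a point at infinity) and `(x₂ : z₂) = (x : z)`,
where the denominator is `t²`. -/
noncomputable def diagS0 {f : k[X]} : Point f → k
  | .affine x _ _ =>
      (formG (fun i => (C (f.coeff i) : k[X])) (C x + X) 1 (C x) 1 ^ 2 -
        4 * formF (fun i => (C (f.coeff i) : k[X])) (C x + X) 1 *
          formF (fun i => (C (f.coeff i) : k[X])) (C x) 1).coeff 2
  | .infinity _ _ =>
      (formG (fun i => (C (f.coeff i) : k[X])) 1 X 1 0 ^ 2 -
        4 * formF (fun i => (C (f.coeff i) : k[X])) 1 X *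
          formF (fun i => (C (f.coeff i) : k[X])) 1 0).coeff 2

open Classical in
/-- The coordinate `σ₈` of the class of `(P₁) + (P₂) - D_∞`, for `P₂ ≠ φ(P₁)`: it is
`(2 y₁ y₂ - G) / (x₁z₂ - x₂z₁)²` if the `x`-coordinates differ. If they agree (so `P₁ = P₂`), the
equation `((x₁z₂ - x₂z₁)² σ₈ + G)² = 4 F F` divided by `(x₁z₂ - x₂z₁)²` degenerates to
`4 F(x₁,z₁) σ₈ + s₀ = 0`, and `F(x₁,z₁) = y₁²`. -/
noncomputable def sigmaEight {f : k[X]} (P₁ P₂ : Point f) : k :=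
  if P₁.xc * P₂.zc - P₂.xc * P₁.zc ≠ 0 then
    (2 * P₁.yc * P₂.yc - formG f.coeff P₁.xc P₁.zc P₂.xc P₂.zc) /
      (P₁.xc * P₂.zc - P₂.xc * P₁.zc) ^ 2
  else - diagS0 P₁ / (4 * P₁.yc ^ 2)

/-- The coordinates `(0 : a₀² : a₀a₁ : a₀a₂ : a₁² - a₀a₂ : a₁a₂ : a₂² : σ₈)` of the image in the
Kummer variety of the class of `(P₁) + (P₂) - D_∞`, where
`(z₁ x - x₁ z)(z₂ x - x₂ z) = a₀ x² + a₁ x z + a₂ z²`. -/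
noncomputable def thetaVec {f : k[X]} (P₁ P₂ : Point f) : Fin 8 → k :=
  let a₀ := P₁.zc * P₂.zc
  let a₁ := - (P₁.xc * P₂.zc + P₂.xc * P₁.zc)
  let a₂ := P₁.xc * P₂.xc
  ![0, a₀ ^ 2, a₀ * a₁, a₀ * a₂, a₁ ^ 2 - a₀ * a₂, a₁ * a₂, a₂ ^ 2, sigmaEight P₁ P₂]

/-- The coordinates on the complement of the theta divisor, where a class is given by polynomials
`a`, `b`, `c` of degree at most `4` with `b² - a c = f`. With `m i j = 2 bᵢbⱼ - aᵢcⱼ - aⱼcᵢ`, the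
coordinates `ξ₂, …, ξ₇` are determined by the identity
`(2 b(x)b(x') - a(x)c(x') - a(x')c(x) - G(x,x')) / (x - x')² =
  ξ₂ (xx')² + ξ₃ (x+x')xx' + ξ₄ (x²+xx'+x'²) + ξ₅ xx' + ξ₆ (x+x') + ξ₇`,
and `ξ₁ = 1`, `ξ₈ = ξ₂ξ₇ - ξ₃ξ₆ + ξ₄ξ₅`. -/
def genericVec (a b c : k[X]) : Fin 8 → k :=
  let m : ℕ → ℕ → k := fun i j =>
    2 * b.coeff i * b.coeff j - a.coeff i * c.coeff j - a.coeff j * c.coeff i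
  ![1, m 4 2, m 4 1, m 4 0, m 3 1 + m 4 0, m 3 0, m 2 0,
    m 4 2 * m 2 0 - m 4 1 * m 3 0 + m 4 0 * (m 3 1 + m 4 0)]

/-- The image `(0 : ⋯ : 0 : 1)` of the origin of the Jacobian. -/
def originVec : Fin 8 → k := ![0, 0, 0, 0, 0, 0, 0, 1]

theorem originVec_ne_zero : (originVec : Fin 8 → k) ≠ 0 := by
  intro h
  have h7 := congrFun h 7
  exact one_ne_zero (α := k) h7

variable [IsAlgClosed k]

/-- A square root of the coefficient of `x⁸` of `f`. -/
noncomputable def infRoot (f : k[X]) : k :=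
  (IsAlgClosed.exists_pow_nat_eq (f.coeff 8) two_pos).choose

theorem infRoot_sq (f : k[X]) : infRoot f ^ 2 = f.coeff 8 :=
  (IsAlgClosed.exists_pow_nat_eq (f.coeff 8) two_pos).choose_spec

/-- The divisor `D_∞`: the sum `(∞₁) + (∞₂)` of the two points at infinity if `deg f = 8`, and
`2 (∞)` if `deg f = 7`. -/
noncomputable def Dinf (f : k[X]) : Divisor f :=
  pt (.infinity (infRoot f) (infRoot_sq f)) +
    pt (Point.invol (.infinity (infRoot f) (infRoot_sq f)))

/-- The map `λ : C → J`, `P ↦ {P, P} = [2 (P) - D_∞]`. -/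
noncomputable def lam {f : k[X]} (P : Point f) : Jac f :=
  ⟨cls f (2 • pt P - Dinf f), AddSubgroup.mem_map_of_mem _ (by
    rw [AddMonoidHom.mem_ker, map_sub, map_nsmul, Dinf, map_add, deg_pt, deg_pt, deg_pt]
    norm_num)⟩

/-- `R` is the point given by the above formula for a representation `Q = [(P₁) + (P₂) - D_∞]`,
with `(P₁) + (P₂)` in general position. -/
def IsThetaImage {f : k[X]} (Q : Jac f) (R : ℙ k (Fin 8 → k)) : Prop :=
  ∃ P₁ P₂ : Point f, IsGeneralPosition (pt P₁ + pt P₂) ∧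
    (Q : Pic f) = cls f (pt P₁ + pt P₂ - Dinf f) ∧
    ∃ hv : thetaVec P₁ P₂ ≠ 0, R = Projectivization.mk k (thetaVec P₁ P₂) hv

/-- `R` is the point given by the above formula for a representation `Q = [D - 2 D_∞]`, with `D`
of degree `4` in general position, cut out on `C` by the forms `A(x, z)` and `y - B(x, z)` of
weight `4`, where `B² - A C = F`. -/
def IsGenericImage {f : k[X]} (Q : Jac f) (R : ℙ k (Fin 8 → k)) : Prop :=
  ∃ (D : Divisor f) (a b c : k[X]), IsGeneralPosition D ∧ deg f D = 4 ∧
    (Q : Pic f) = cls f (D - 2 • Dinf f) ∧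
    a.natDegree ≤ 4 ∧ b.natDegree ≤ 4 ∧ c.natDegree ≤ 4 ∧ b ^ 2 - a * c = f ∧
    (∀ P : Point f, D P = (min (ordForm f 0 a 0 P) (ordForm f 0 (-b) 1 P) : ℕ)) ∧
    ∃ hv : genericVec a b c ≠ 0, R = Projectivization.mk k (genericVec a b c) hv

open Classical in
/-- The map `κ : J → ℙ⁷` onto the Kummer variety. Every nonzero class is either of the form
`[D - D_∞]` with `D` of degree `2` in general position or of the form `[D - 2 D_∞]` with `D` of
degree `4` in general position; the formulas above do not depend on the choice of `D`, `a`, `b`,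
`c`. The origin is mapped to `(0 : ⋯ : 0 : 1)`. -/
noncomputable def kappa (f : k[X]) (Q : Jac f) : ℙ k (Fin 8 → k) :=
  if Q = 0 then Projectivization.mk k originVec originVec_ne_zero
  else if h : ∃ R, IsThetaImage Q R then h.choose
  else if h : ∃ R, IsGenericImage Q R then h.choose
  else Projectivization.mk k originVec originVec_ne_zero

/-- The Kummer variety `K = κ(J)`. -/
def Kummer (f : k[X]) : Set (ℙ k (Fin 8 → k)) := Set.range (kappa f)

end Curve

section Rational

/-- An algebraic closure of `ℚ`. -/
abbrev Qbar : Type := AlgebraicClosure ℚ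

/-- The polynomial `f` seen over the algebraic closure. -/
noncomputable abbrev bar (f : ℚ[X]) : Qbar[X] := f.map (algebraMap ℚ Qbar)

/-- The action of the absolute Galois group of `ℚ` on the points of `C`. -/
noncomputable def galPoint {f : ℚ[X]} (τ : Qbar ≃ₐ[ℚ] Qbar) : Point (bar f) → Point (bar f)
  | .affine x y h => .affine (τ x) (τ y) (by
      rw [← map_pow, h, eval_map_algebraMap, eval_map_algebraMap]
      exact (aeval_algHom_apply τ.toAlgHom x f).symm)
  | .infinity s h => .infinity (τ s) (by
      rw [← map_pow, h, coeff_map, AlgEquiv.commutes])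

/-- The action of the absolute Galois group of `ℚ` on divisors. -/
noncomputable def galDivisor {f : ℚ[X]} (τ : Qbar ≃ₐ[ℚ] Qbar) (D : Divisor (bar f)) :
    Divisor (bar f) := Finsupp.mapDomain (galPoint τ) D

/-- The group `J(ℚ)` as a set: the Galois-invariant classes of degree `0`. -/
def rationalJac (f : ℚ[X]) : Set (Jac (bar f)) :=
  {Q | ∃ D : Divisor (bar f), cls (bar f) D = Q ∧
    ∀ τ : Qbar ≃ₐ[ℚ] Qbar, cls (bar f) (galDivisor τ D) = Q}

/-- The point has rational coordinates. -/
def IsRationalPoint {f : ℚ[X]} : Point (bar f) → Prop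
  | .affine x y _ => (∃ a : ℚ, algebraMap ℚ Qbar a = x) ∧ ∃ b : ℚ, algebraMap ℚ Qbar b = y
  | .infinity s _ => ∃ b : ℚ, algebraMap ℚ Qbar b = s

/-- The rational point `(σ₁ : ⋯ : σ₈)` of `ℙ⁷`; the coordinate `σᵢ` is `σ (i - 1)`. -/
noncomputable def ratPoint (σ : Fin 8 → ℚ) (hσ : σ ≠ 0) : ℙ Qbar (Fin 8 → Qbar) :=
  Projectivization.mk Qbar (fun i => algebraMap ℚ Qbar (σ i)) (by
    intro h
    apply hσ
    funext i
    exact (map_eq_zero (algebraMap ℚ Qbar)).1 (congrFun h i))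

end Rational

end HypGenusThree

/-!
The hyperplane `σ₁ = 0` of the Kummer variety consists of the origin and of the images of classes
`[(P₁) + (P₂) - D_∞]`, for which `(σ₂ : σ₃ : σ₄) = (a₀² : a₀a₁ : a₀a₂)`. The conditions on `σ`
therefore say that `P₁` and `P₂` are affine with the same `x`-coordinate; general position then
leaves only `P₁ = P₂`, not a Weierstrass point (`exists_eq_lam_of_kappa_eq`). Since
`(x - x(P))² = 0` cuts out `2 (P) + 2 (φ(P)) - 2 D_∞`, one has `-{P, P} = {φ(P), φ(P)}`, and the
`x`-coordinate is read off from `σ`, which gives the fibre (`kappa_preimage_thetaVec`).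

What makes this work, and makes `κ` computable on these classes at all, is that the class `{P, P}`
of an affine non-Weierstrass point determines `P` (`eq_of_cls_eq`). This rests on the equality
`L(2 D_∞) = ⟨1, x, x²⟩` in the form of `apply_invol_of_sub_mem_principal`: an effective divisor
equivalent to `2 D_∞` is invariant under `φ`. To see it, write the function as `(a + b y) / c`;
then `c` divides `b` locally at every affine point up to less than one ramification index of
`x`, so `deg c ≤ deg b`, whereas the order at infinity forces `deg b < deg c` (`y` has weight `4`).
The orders of vanishing are computed from a local parameter, `x - x₀` or `y`, at each smooth point.

For rationality, Galois automorphisms preserve principal divisors, so if `{P, P}` is an invariant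
class, `eq_of_cls_eq` shows that `P` is fixed by the Galois group.
-/

namespace HypGenusThree

/-! ### Orders with respect to a locally principal maximal ideal -/

section LocalOrder

variable {R : Type*} [CommRing R]

/-- `π` is a local generator of the ideal `I`: it lies in `I`, and generates `I` after inverting
elements outside `I`. -/
structure IsUniformizer (I : Ideal R) (π : R) : Prop where
  mem : π ∈ I
  ne_zero : π ≠ 0
  dvd : ∀ r ∈ I, ∃ w ∉ I, π ∣ w * r

/-- `r` equals `π ^ n` up to factors outside `I`. -/
def HasOrder (I : Ideal R) (π r : R) (n : ℕ) : Prop :=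
  ∃ w ∉ I, ∃ s ∉ I, w * r = π ^ n * s

variable {I : Ideal R} {π : R}

/-- Membership in `I ^ n` can be tested after localizing at `I`. -/
theorem IsUniformizer.mem_pow_iff [hI : I.IsMaximal] (h : IsUniformizer I π) (r : R) (n : ℕ) :
    r ∈ I ^ n ↔ ∃ w ∉ I, π ^ n ∣ w * r := by
  have hp : I.IsPrime := hI.isPrime
  constructor
  · intro hr
    induction n generalizing r with
    | zero => exact ⟨1, (Ideal.ne_top_iff_one I).1 hI.ne_top, by simp⟩
    | succ n ih =>
      rw [pow_succ] at hr
      refine Submodule.mul_induction_on hr ?_ ?_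
      · intro a ha b hb
        obtain ⟨w, hw, c, hc⟩ := ih a ha
        obtain ⟨w', hw', d, hd⟩ := h.dvd b hb
        refine ⟨w * w', hp.mul_notMem hw hw', c * d, ?_⟩
        linear_combination (w' * b) * hc + (π ^ n * c) * hd
      · rintro a b ⟨w, hw, c, hc⟩ ⟨w', hw', d, hd⟩
        refine ⟨w * w', hp.mul_notMem hw hw', c * w' + d * w, ?_⟩
        linear_combination w' * hc + w * hd
  · rintro ⟨w, hw, c, hc⟩
    have hwr : w * r ∈ I ^ n := by
      rw [hc]
      exact Ideal.mul_mem_right _ _ (Ideal.pow_mem_pow h.mem n)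
    obtain ⟨a, i, hi, hai⟩ := hI.exists_inv hw
    -- `w` is invertible modulo `I ^ n`, because `1 - i` divides `1 - i ^ n`.
    obtain ⟨q, hq⟩ := sub_dvd_pow_sub_pow (1 : R) i n
    have : r = i ^ n * r + (a * q) * (w * r) := by
      rw [one_pow] at hq
      linear_combination r * hq - q * r * hai
    rw [this]
    exact add_mem (Ideal.mul_mem_right _ _ (Ideal.pow_mem_pow hi n)) (Ideal.mul_mem_left _ _ hwr)

theorem HasOrder.mem_pow_iff [IsDomain R] [hI : I.IsMaximal] (h : IsUniformizer I π) {r : R}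
    {n : ℕ} (hr : HasOrder I π r n) (m : ℕ) : r ∈ I ^ m ↔ m ≤ n := by
  have hp : I.IsPrime := hI.isPrime
  obtain ⟨w, hw, s, hs, hws⟩ := hr
  rw [h.mem_pow_iff]
  constructor
  · rintro ⟨w', hw', t, ht⟩
    by_contra! hlt
    obtain ⟨j, rfl⟩ := Nat.exists_eq_add_of_lt hlt
    have key : π ^ n * (s * w') = π ^ n * (π * (π ^ j * t * w)) := by
      linear_combination (-w') * hws + w * ht
    have := mul_left_cancel₀ (pow_ne_zero n h.ne_zero) key
    exact hp.mul_notMem hs hw' (this ▸ Ideal.mul_mem_right _ _ h.mem)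
  · intro hmn
    exact ⟨w, hw, hws ▸ Dvd.dvd.mul_right (pow_dvd_pow π hmn) s⟩

theorem HasOrder.sSup_eq [IsDomain R] [I.IsMaximal] (h : IsUniformizer I π) {r : R}
    {n : ℕ} (hr : HasOrder I π r n) : sSup {m : ℕ | r ∈ I ^ m} = n := by
  have : {m : ℕ | r ∈ I ^ m} = Set.Iic n := Set.ext fun m => hr.mem_pow_iff h m
  rw [this, csSup_Iic]

theorem HasOrder.mul [hI : I.IsPrime] {r r' : R} {n n' : ℕ} (hr : HasOrder I π r n)
    (hr' : HasOrder I π r' n') : HasOrder I π (r * r') (n + n') := by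
  obtain ⟨w, hw, s, hs, h⟩ := hr
  obtain ⟨w', hw', s', hs', h'⟩ := hr'
  exact ⟨w * w', hI.mul_notMem hw hw', s * s', hI.mul_notMem hs hs', by
    linear_combination (w' * r') * h + π ^ n * s * h'⟩

/-- A divisor of an element of finite order has finite order: its order is the largest `m` with
`r ∈ I ^ m`, which is bounded by the order of the multiple. -/
theorem HasOrder.exists_of_dvd [IsDomain R] [hI : I.IsMaximal] (h : IsUniformizer I π) {r N : R}
    {n : ℕ} (hN : HasOrder I π N n) (hrN : r ∣ N) : ∃ m, HasOrder I π r m := by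
  classical
  have hp : I.IsPrime := hI.isPrime
  have hex : ∃ m, r ∉ I ^ (m + 1) := by
    refine ⟨n, fun hr => ?_⟩
    have := (hN.mem_pow_iff h (n + 1)).1 (Ideal.mem_of_dvd _ hrN hr)
    omega
  refine ⟨Nat.find hex, ?_⟩
  have hmem : r ∈ I ^ Nat.find hex := by
    cases hm : Nat.find hex with
    | zero => simp
    | succ m =>
      by_contra hc
      exact Nat.find_min hex (m := m) (by omega) hc
  obtain ⟨w, hw, s, hs⟩ := (h.mem_pow_iff _ _).1 hmem
  refine ⟨w, hw, s, fun hsI => Nat.find_spec hex ?_, hs⟩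
  obtain ⟨w', hw', t, ht⟩ := h.dvd s hsI
  refine (h.mem_pow_iff _ _).2 ⟨w' * w, hp.mul_notMem hw' hw, t, ?_⟩
  linear_combination w' * hs + π ^ Nat.find hex * ht

end LocalOrder

/-! ### The coordinate ring of `y² = g(x)` -/

section CoordRing

variable {k : Type*} [Field k] {g : k[X]}

/-- The function `u(x) + v(x) y` on the affine curve `y² = g(x)`. -/
noncomputable def elt (g u v : k[X]) : CoordRing g :=
  AdjoinRoot.of _ u + AdjoinRoot.of _ v * AdjoinRoot.root (X ^ 2 - C g : k[X][X])

theorem root_sq (g : k[X]) :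
    AdjoinRoot.root (X ^ 2 - C g : k[X][X]) ^ 2 = AdjoinRoot.of (X ^ 2 - C g : k[X][X]) g := by
  have h := AdjoinRoot.eval₂_root (X ^ 2 - C g : k[X][X])
  rw [eval₂_sub, eval₂_pow, eval₂_X, eval₂_C] at h
  exact sub_eq_zero.1 h

theorem elt_mul (u v u' v' : k[X]) :
    elt g u v * elt g u' v' = elt g (u * u' + g * (v * v')) (u * v' + v * u') := by
  simp only [elt, map_add, map_mul]
  linear_combination (AdjoinRoot.of (X ^ 2 - C g : k[X][X]) v *
    AdjoinRoot.of (X ^ 2 - C g : k[X][X]) v') * root_sq g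

theorem elt_eq_mk (u v : k[X]) : elt g u v = AdjoinRoot.mk _ (C v * X + C u) := by
  simp [elt, add_comm]

theorem monic_equation (g : k[X]) : (X ^ 2 - C g : k[X][X]).Monic :=
  monic_X_pow_sub_C g two_ne_zero

theorem exists_eq_elt (r : CoordRing g) : ∃ u v, r = elt g u v := by
  obtain ⟨p, rfl⟩ := AdjoinRoot.mk_surjective r
  have hlt : (p %ₘ (X ^ 2 - C g)).natDegree < 2 := by
    simpa using natDegree_modByMonic_lt p (monic_equation g) (fun h => by
      have := congrArg natDegree h
      simp at this)
  obtain ⟨a, b, hab⟩ := exists_eq_X_add_C_of_natDegree_le_one (Nat.lt_succ_iff.1 hlt)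
  refine ⟨b, a, ?_⟩
  rw [elt_eq_mk, ← hab, AdjoinRoot.mk_eq_mk]
  exact ⟨p /ₘ (X ^ 2 - C g), by
    linear_combination (-1 : k[X][X]) * modByMonic_add_div p (X ^ 2 - C g)⟩

theorem elt_eq_zero_iff {u v : k[X]} : elt g u v = 0 ↔ u = 0 ∧ v = 0 := by
  constructor
  · intro h
    rw [elt_eq_mk] at h
    have h0 : (C v * X + C u : k[X][X]) = 0 := by
      by_contra hne
      refine AdjoinRoot.mk_ne_zero_of_natDegree_lt (monic_equation g) hne ?_ h
      rw [natDegree_X_pow_sub_C]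
      exact lt_of_le_of_lt natDegree_linear_le one_lt_two
    have h1 := congrArg (fun p => coeff p 0) h0
    have h2 := congrArg (fun p => coeff p 1) h0
    simp at h1 h2
    exact ⟨h1, h2⟩
  · rintro ⟨rfl, rfl⟩
    simp [elt]

/-- The norm `u² - g v²` of `u + v y` vanishes only if `u + v y` does, since `g` is not a square. -/
theorem norm_ne_zero (hg : ¬ IsSquare g) {u v : k[X]} (h : u ≠ 0 ∨ v ≠ 0) :
    u ^ 2 - g * v ^ 2 ≠ 0 := by
  intro h0
  rw [sub_eq_zero] at h0
  by_cases hv : v = 0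
  · subst hv
    simp at h0 h
    exact h h0
  · have hdvd : v ∣ u := (IsIntegrallyClosed.pow_dvd_pow_iff two_ne_zero).1 ⟨g, by rw [h0, mul_comm]⟩
    obtain ⟨w, rfl⟩ := hdvd
    refine hg ⟨w, mul_right_cancel₀ (pow_ne_zero 2 hv) ?_⟩
    rw [← h0]
    ring

theorem elt_mul_conj (u v : k[X]) :
    elt g u v * elt g u (-v) = elt g (u ^ 2 - g * v ^ 2) 0 := by
  rw [elt_mul]
  congr 1 <;> ring

theorem isDomain_coordRing (hg : ¬ IsSquare g) : IsDomain (CoordRing g) := by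
  have : Nontrivial (CoordRing g) := ⟨⟨elt g 1 0, 0, fun h => by simpa using elt_eq_zero_iff.1 h⟩⟩
  have : NoZeroDivisors (CoordRing g) := by
    refine ⟨fun {a b} hab => ?_⟩
    obtain ⟨u, v, rfl⟩ := exists_eq_elt a
    obtain ⟨u', v', rfl⟩ := exists_eq_elt b
    by_contra! hne
    have hN : u ^ 2 - g * v ^ 2 ≠ 0 := norm_ne_zero hg (by
      by_contra! h
      exact hne.1 (elt_eq_zero_iff.2 h))
    have h0 : elt g (u ^ 2 - g * v ^ 2) 0 * elt g u' v' = 0 := by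
      rw [← elt_mul_conj, mul_right_comm, hab, zero_mul]
    rw [elt_mul, elt_eq_zero_iff] at h0
    refine hne.2 (elt_eq_zero_iff.2 ⟨?_, ?_⟩)
    · simpa [hN] using h0.1
    · simpa [hN] using h0.2
  exact NoZeroDivisors.to_isDomain _

/-- Evaluation of functions at the point `(x₀, y₀)`. -/
noncomputable def evalPt (g : k[X]) (x₀ y₀ : k) (h : y₀ ^ 2 = g.eval x₀) : CoordRing g →+* k :=
  AdjoinRoot.lift (evalRingHom x₀) y₀ (by simp [h])

theorem evalPt_elt {x₀ y₀ : k} (h : y₀ ^ 2 = g.eval x₀) (u v : k[X]) :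
    evalPt g x₀ y₀ h (elt g u v) = u.eval x₀ + v.eval x₀ * y₀ := by
  simp [evalPt, elt]

theorem pointIdeal_eq_ker {x₀ y₀ : k} (h : y₀ ^ 2 = g.eval x₀) :
    pointIdeal g x₀ y₀ = RingHom.ker (evalPt g x₀ y₀ h) := by
  apply le_antisymm
  · rw [pointIdeal, Ideal.span_le]
    rintro _ (rfl | rfl) <;> simp [evalPt]
  · intro r hr
    obtain ⟨u, v, rfl⟩ := exists_eq_elt r
    rw [RingHom.mem_ker, evalPt_elt] at hr
    obtain ⟨u', hu⟩ := X_sub_C_dvd_sub_C_eval (a := x₀) (p := u)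
    obtain ⟨v', hv⟩ := X_sub_C_dvd_sub_C_eval (a := x₀) (p := v)
    rw [sub_eq_iff_eq_add] at hu hv
    rw [pointIdeal, Ideal.mem_span_pair]
    refine ⟨elt g u' v', AdjoinRoot.of _ (C (v.eval x₀)), ?_⟩
    have h0 := congrArg (fun t => AdjoinRoot.of (X ^ 2 - C g : k[X][X]) (C t)) hr
    have hu' := congrArg (AdjoinRoot.of (X ^ 2 - C g : k[X][X])) hu
    have hv' := congrArg (AdjoinRoot.of (X ^ 2 - C g : k[X][X])) hv
    simp only [elt, map_add, map_mul, map_zero, map_sub] at h0 hu' hv' ⊢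
    rw [hu', hv']
    linear_combination -h0

theorem isMaximal_pointIdeal {x₀ y₀ : k} (h : y₀ ^ 2 = g.eval x₀) :
    (pointIdeal g x₀ y₀).IsMaximal := by
  rw [pointIdeal_eq_ker h]
  exact RingHom.ker_isMaximal_of_surjective _ fun c => ⟨elt g (C c) 0, by simp [evalPt_elt]⟩

end CoordRing

/-! ### Orders of vanishing at smooth points -/

section SmoothPoint

variable {k : Type*} [Field k] {g : k[X]} {x₀ y₀ : k}

/-- The curve `y² = g(x)` is irreducible, and `(x₀, y₀)` is a smooth point of it
(in characteristic `≠ 2`). -/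
structure IsSmoothPoint (g : k[X]) (x₀ y₀ : k) : Prop where
  not_isSquare : ¬ IsSquare g
  on_curve : y₀ ^ 2 = g.eval x₀
  smooth : y₀ = 0 → (derivative g).eval x₀ ≠ 0

open Classical in
/-- The ramification index of `(x, y) ↦ x` at a point with `y`-coordinate `y₀`. -/
noncomputable def ramIndex (y₀ : k) : ℕ := if y₀ = 0 then 2 else 1

open Classical in
/-- The order of vanishing of the function `y` at a point with `y`-coordinate `y₀`. -/
noncomputable def ordY (y₀ : k) : ℕ := if y₀ = 0 then 1 else 0

theorem ordY_lt_ramIndex (y₀ : k) : ordY y₀ < ramIndex y₀ := by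
  unfold ordY ramIndex
  split <;> omega

theorem IsSmoothPoint.notMem_iff (h : IsSmoothPoint g x₀ y₀) {u v : k[X]} :
    elt g u v ∉ pointIdeal g x₀ y₀ ↔ u.eval x₀ + v.eval x₀ * y₀ ≠ 0 := by
  rw [pointIdeal_eq_ker h.on_curve, RingHom.mem_ker, evalPt_elt]

/-- The function `x - x₀` is a local parameter if `y₀ ≠ 0`, because
`(y + y₀) (y - y₀) = g(x) - g(x₀)` is a multiple of it; if `y₀ = 0`, then `y` is one, because
`y² = (x - x₀) h(x)` with `h(x₀) = g'(x₀) ≠ 0`. -/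
theorem IsSmoothPoint.exists_isUniformizer [CharZero k] (h : IsSmoothPoint g x₀ y₀) :
    ∃ π, IsUniformizer (pointIdeal g x₀ y₀) π ∧
      (∀ u : k[X], u ≠ 0 → HasOrder (pointIdeal g x₀ y₀) π (elt g u 0)
        (ramIndex y₀ * u.rootMultiplicity x₀)) ∧
      HasOrder (pointIdeal g x₀ y₀) π (elt g 0 1) (ordY y₀) := by
  have hone : elt g 1 0 ∉ pointIdeal g x₀ y₀ := h.notMem_iff.2 (by simp)
  have elt_one : elt g 1 0 = 1 := by simp [elt]
  by_cases hy : y₀ = 0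
  · subst hy
    have hg0 : g.eval x₀ = 0 := by rw [← h.on_curve]; simp
    obtain ⟨q, hq⟩ := dvd_iff_isRoot.2 hg0
    have hq0 : elt g q 0 ∉ pointIdeal g x₀ 0 := h.notMem_iff.2 (by
      have := h.smooth rfl
      rw [hq] at this
      simpa [derivative_mul] using this)
    have hsq : elt g 0 1 ^ 2 = elt g q 0 * elt g (X - C x₀) 0 := by
      rw [pow_two, elt_mul, elt_mul]
      congr 1
      · linear_combination hq
      · simp
    refine ⟨elt g 0 1, ⟨?_, ?_, ?_⟩, ?_, ?_⟩
    · by_contra hc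
      exact (h.notMem_iff.1 hc) (by simp)
    · intro hc
      simpa using elt_eq_zero_iff.1 hc
    · intro r hr
      obtain ⟨a, b, rfl⟩ := Ideal.mem_span_pair.1 hr
      refine ⟨elt g q 0, hq0, a * elt g 0 1 + b * elt g q 0, ?_⟩
      have h1 : AdjoinRoot.of (X ^ 2 - C g : k[X][X]) (X - C x₀) = elt g (X - C x₀) 0 := by
        simp [elt]
      have h2 : AdjoinRoot.root (X ^ 2 - C g : k[X][X]) - AdjoinRoot.of _ (C 0) = elt g 0 1 := by
        simp [elt]
      rw [h1, h2]
      linear_combination (-a) * hsq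
    · intro u hu
      obtain ⟨u', hu', hnd⟩ := exists_eq_pow_rootMultiplicity_mul_and_not_dvd u hu x₀
      set m := u.rootMultiplicity x₀
      have hfac : elt g u 0 = elt g (X - C x₀) 0 ^ m * elt g u' 0 := by
        rw [hu']
        simp [elt]
      refine ⟨elt g q 0 ^ m, ?_, elt g u' 0, h.notMem_iff.2 ?_, ?_⟩
      · have hp := (isMaximal_pointIdeal h.on_curve).isPrime
        exact fun hc => hq0 (hp.mem_of_pow_mem _ hc)
      · simpa [dvd_iff_isRoot, IsRoot] using hnd
      · rw [hfac, ramIndex, if_pos rfl, pow_mul, hsq, mul_pow]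
        ring
    · exact ⟨elt g 1 0, hone, elt g 1 0, hone, by rw [ordY, if_pos rfl]; ring⟩
  · have hw : elt g (C y₀) 1 ∉ pointIdeal g x₀ y₀ := h.notMem_iff.2 (by
      simpa [← two_mul] using hy)
    refine ⟨elt g (X - C x₀) 0, ⟨?_, ?_, ?_⟩, ?_, ?_⟩
    · by_contra hc
      exact (h.notMem_iff.1 hc) (by simp)
    · intro hc
      exact X_sub_C_ne_zero x₀ (elt_eq_zero_iff.1 hc).1
    · intro r hr
      obtain ⟨a, b, rfl⟩ := Ideal.mem_span_pair.1 hr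
      obtain ⟨q, hq⟩ := X_sub_C_dvd_sub_C_eval (a := x₀) (p := g)
      refine ⟨elt g (C y₀) 1, hw, a * elt g (C y₀) 1 + b * elt g q 0, ?_⟩
      have h1 : AdjoinRoot.of (X ^ 2 - C g : k[X][X]) (X - C x₀) = elt g (X - C x₀) 0 := by
        simp [elt]
      have h2 : AdjoinRoot.root (X ^ 2 - C g : k[X][X]) - AdjoinRoot.of _ (C y₀) =
          elt g (-C y₀) 1 := by
        simp [elt]
        ring
      have h3 : elt g (C y₀) 1 * elt g (-C y₀) 1 = elt g (X - C x₀) 0 * elt g q 0 := by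
        rw [elt_mul, elt_mul]
        congr 1
        · have : (C y₀ : k[X]) ^ 2 = C (g.eval x₀) := by rw [← C_pow, h.on_curve]
          linear_combination hq - this
        · ring
      rw [h1, h2]
      linear_combination b * h3
    · intro u hu
      obtain ⟨u', hu', hnd⟩ := exists_eq_pow_rootMultiplicity_mul_and_not_dvd u hu x₀
      set m := u.rootMultiplicity x₀
      have hfac : elt g u 0 = elt g (X - C x₀) 0 ^ m * elt g u' 0 := by
        rw [hu']
        simp [elt]
      refine ⟨1, elt_one ▸ hone, elt g u' 0, h.notMem_iff.2 ?_, ?_⟩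
      · simpa [dvd_iff_isRoot, IsRoot] using hnd
      · rw [hfac, ramIndex, if_neg hy, one_mul, one_mul]
    · exact ⟨elt g 1 0, hone, elt g 0 1, h.notMem_iff.2 (by simpa using hy), by
        rw [ordY, if_neg hy, elt_one]; ring⟩

/-- A nonzero function has a well-defined order at a smooth point, since it divides its norm. -/
theorem IsSmoothPoint.exists_hasOrder (h : IsSmoothPoint g x₀ y₀) {π : CoordRing g}
    (hπ : IsUniformizer (pointIdeal g x₀ y₀) π)
    (hx : ∀ u : k[X], u ≠ 0 → HasOrder (pointIdeal g x₀ y₀) π (elt g u 0)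
        (ramIndex y₀ * u.rootMultiplicity x₀)) {u v : k[X]} (huv : u ≠ 0 ∨ v ≠ 0) :
    ∃ n, HasOrder (pointIdeal g x₀ y₀) π (elt g u v) n := by
  have := isDomain_coordRing h.not_isSquare
  have := isMaximal_pointIdeal h.on_curve
  exact HasOrder.exists_of_dvd hπ (hx _ (norm_ne_zero h.not_isSquare huv))
    ⟨_, (elt_mul_conj u v).symm⟩

theorem vanishOrder_eq_sSup (u v : k[X]) :
    vanishOrder g x₀ y₀ u v = sSup {n : ℕ | elt g u v ∈ pointIdeal g x₀ y₀ ^ n} := rfl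

theorem IsSmoothPoint.le_vanishOrder_iff [CharZero k] (h : IsSmoothPoint g x₀ y₀) {u v : k[X]}
    (huv : u ≠ 0 ∨ v ≠ 0) (n : ℕ) :
    n ≤ vanishOrder g x₀ y₀ u v ↔ elt g u v ∈ pointIdeal g x₀ y₀ ^ n := by
  have := isDomain_coordRing h.not_isSquare
  have := isMaximal_pointIdeal h.on_curve
  obtain ⟨π, hπ, hx, -⟩ := h.exists_isUniformizer
  obtain ⟨m, hm⟩ := h.exists_hasOrder hπ hx huv
  rw [vanishOrder_eq_sSup, hm.sSup_eq hπ, hm.mem_pow_iff hπ]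

theorem IsSmoothPoint.vanishOrder_mul [CharZero k] (h : IsSmoothPoint g x₀ y₀) {u v u' v' : k[X]}
    (huv : u ≠ 0 ∨ v ≠ 0) (huv' : u' ≠ 0 ∨ v' ≠ 0) :
    vanishOrder g x₀ y₀ (u * u' + g * (v * v')) (u * v' + v * u') =
      vanishOrder g x₀ y₀ u v + vanishOrder g x₀ y₀ u' v' := by
  have := isDomain_coordRing h.not_isSquare
  have := isMaximal_pointIdeal h.on_curve
  have hp := (isMaximal_pointIdeal h.on_curve).isPrime
  obtain ⟨π, hπ, hx, -⟩ := h.exists_isUniformizer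
  obtain ⟨m, hm⟩ := h.exists_hasOrder hπ hx huv
  obtain ⟨n, hn⟩ := h.exists_hasOrder hπ hx huv'
  have hmn := hm.mul hn
  rw [elt_mul] at hmn
  simp only [vanishOrder_eq_sSup]
  rw [hm.sSup_eq hπ, hn.sSup_eq hπ, hmn.sSup_eq hπ]

theorem IsSmoothPoint.vanishOrder_poly [CharZero k] (h : IsSmoothPoint g x₀ y₀) {u : k[X]} (hu : u ≠ 0) :
    vanishOrder g x₀ y₀ u 0 = ramIndex y₀ * u.rootMultiplicity x₀ := by
  have := isDomain_coordRing h.not_isSquare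
  have := isMaximal_pointIdeal h.on_curve
  obtain ⟨π, hπ, hx, -⟩ := h.exists_isUniformizer
  rw [vanishOrder_eq_sSup, (hx u hu).sSup_eq hπ]

theorem IsSmoothPoint.vanishOrder_poly_mul_y [CharZero k] (h : IsSmoothPoint g x₀ y₀) {v : k[X]} (hv : v ≠ 0) :
    vanishOrder g x₀ y₀ 0 v = ramIndex y₀ * v.rootMultiplicity x₀ + ordY y₀ := by
  have := isDomain_coordRing h.not_isSquare
  have := isMaximal_pointIdeal h.on_curve
  have hp := (isMaximal_pointIdeal h.on_curve).isPrime
  obtain ⟨π, hπ, hx, hy⟩ := h.exists_isUniformizer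
  have hm := (hx v hv).mul hy
  rw [elt_mul] at hm
  simp only [mul_zero, mul_one, add_zero] at hm
  rw [vanishOrder_eq_sSup, hm.sSup_eq hπ]

/-- The isomorphism `u + v y ↦ τu + ε τv y` of coordinate rings maps powers of the ideal of
`(x₀, y₀)` into those of the ideal of `(τ x₀, ε τ y₀)`. -/
theorem elt_mem_pointIdeal_pow_map {k k' : Type*} [Field k] [Field k'] (τ : k ≃+* k') {ε : k}
    (hε : ε ^ 2 = 1) {g : k[X]} {g' : k'[X]} (hg' : g.map (τ : k →+* k') = g') {x₀ y₀ : k}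
    {u v : k[X]} {n : ℕ} (hmem : elt g u v ∈ pointIdeal g x₀ y₀ ^ n) :
    elt g' (u.map (τ : k →+* k')) ((C ε * v).map (τ : k →+* k')) ∈
      pointIdeal g' (τ x₀) (τ (ε * y₀)) ^ n := by
  set o := AdjoinRoot.of (X ^ 2 - C g' : k'[X][X])
  have hτε : (C (τ ε) : k'[X]) * C (τ ε) = 1 := by
    rw [← C_mul, ← map_mul, ← pow_two, hε, map_one, C_1]
  have hε' : o (C (τ ε)) ^ 2 = 1 := by
    simpa [pow_two] using congrArg o hτε
  let ψ : CoordRing g →+* CoordRing g' :=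
    AdjoinRoot.lift (o.comp (mapRingHom (τ : k →+* k')))
      (o (C (τ ε)) * AdjoinRoot.root (X ^ 2 - C g' : k'[X][X])) (by
        simp only [eval₂_sub, eval₂_pow, eval₂_X, eval₂_C, RingHom.comp_apply,
          coe_mapRingHom, hg', mul_pow, hε', root_sq, one_mul]
        exact sub_self _)
  have hψ : ψ (elt g u v) = elt g' (u.map (τ : k →+* k')) ((C ε * v).map (τ : k →+* k')) := by
    simp [ψ, elt, o]
    ring
  have hI : (pointIdeal g x₀ y₀).map ψ ≤ pointIdeal g' (τ x₀) (τ (ε * y₀)) := by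
    rw [pointIdeal, Ideal.map_span, Ideal.span_le]
    rintro _ ⟨_, rfl | rfl, rfl⟩
    · apply Ideal.subset_span
      left
      simp [ψ, o]
    · have : ψ (AdjoinRoot.root _ - AdjoinRoot.of _ (C y₀)) = o (C (τ ε)) *
          (AdjoinRoot.root _ - o (C (τ (ε * y₀)))) := by
        simp only [ψ, map_sub, AdjoinRoot.lift_root, AdjoinRoot.lift_of, RingHom.comp_apply,
          coe_mapRingHom, map_C, map_mul, RingHom.coe_coe]
        linear_combination o (C (τ y₀)) * hε'
      rw [this]
      exact Ideal.mul_mem_left _ _ (Ideal.subset_span (by right; rfl))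
  rw [← hψ]
  have := Ideal.mem_map_of_mem ψ hmem
  rw [Ideal.map_pow] at this
  exact Ideal.pow_right_mono hI n this

/-- The order of a function `u + v y` at `(x₀, y₀)` equals the order of `τu + ε τv y` at
`(τ x₀, ε τ y₀)`, for a field automorphism `τ` and `ε² = 1`. This covers both the hyperelliptic
involution (`τ = 1`, `ε = -1`) and the Galois action (`ε = 1`). -/
theorem vanishOrder_transport {k' : Type*} [Field k'] (τ : k ≃+* k') {ε : k} (hε : ε ^ 2 = 1)
    {g' : k'[X]} (hg' : g.map (τ : k →+* k') = g') (u v : k[X]) :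
    vanishOrder g' (τ x₀) (τ (ε * y₀)) (u.map (τ : k →+* k')) ((C ε * v).map (τ : k →+* k')) =
      vanishOrder g x₀ y₀ u v := by
  -- One inclusion, for an arbitrary isomorphism; the other one is its instance for the inverse.
  have hε' : (τ ε) ^ 2 = 1 := by rw [← map_pow, hε, map_one]
  have hεC : (C ε : k[X]) * C ε = 1 := by rw [← C_mul, ← pow_two, hε, C_1]
  have hg : g'.map (τ.symm : k' →+* k) = g := by rw [← hg', map_map]; simp
  have hu : (u.map (τ : k →+* k')).map (τ.symm : k' →+* k) = u := by rw [map_map]; simp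
  have hv : (C (τ ε) * (C ε * v).map (τ : k →+* k')).map (τ.symm : k' →+* k) = v := by
    rw [Polynomial.map_mul, map_map]
    simp [← mul_assoc, hεC]
  have hy : τ.symm (τ ε * τ (ε * y₀)) = y₀ := by
    rw [← map_mul, RingEquiv.symm_apply_apply, ← mul_assoc, ← pow_two, hε, one_mul]
  have hiff : ∀ n, elt g' (u.map (τ : k →+* k')) ((C ε * v).map (τ : k →+* k')) ∈
      pointIdeal g' (τ x₀) (τ (ε * y₀)) ^ n ↔ elt g u v ∈ pointIdeal g x₀ y₀ ^ n := by
    intro n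
    refine ⟨fun h => ?_, fun h => elt_mem_pointIdeal_pow_map τ hε hg' h⟩
    have h1 := elt_mem_pointIdeal_pow_map τ.symm hε' hg h
    rw [hu, hv, hy, RingEquiv.symm_apply_apply] at h1
    exact h1
  simp only [vanishOrder_eq_sSup, hiff]

end SmoothPoint

/-! ### Orders of forms on the projective curve -/

section Forms

variable {k : Type*} [Field k] {f : k[X]}

theorem not_isSquare_of_separable (hsep : f.Separable) (hf : f.natDegree ≠ 0) : ¬ IsSquare f := by
  rintro ⟨h, hh⟩
  apply hf
  rw [hh]
  exact natDegree_eq_zero_of_isUnit (by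
    have := hsep.squarefree h ⟨1, by rw [hh, mul_one]⟩
    exact this.mul this)

theorem reflect_ne_zero {u : k[X]} (hu : u ≠ 0) (N : ℕ) : u.reflect N ≠ 0 :=
  fun h => hu (reflect_eq_zero_iff.1 h)

/-- A square root of `F(1, z)` would dehomogenise to a square root of `f`. -/
theorem not_isSquare_reflect (hsep : f.Separable) (hdeg : f.natDegree = 7 ∨ f.natDegree = 8) :
    ¬ IsSquare (f.reflect 8) := by
  rintro ⟨h, hh⟩
  refine not_isSquare_of_separable hsep (by omega) ⟨h.reflect 4, ?_⟩
  have hle : (f.reflect 8).natDegree ≤ 8 := by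
    rw [natDegree_le_iff_coeff_eq_zero]
    intro n hn
    rw [coeff_reflect, revAt_eq_self_of_lt hn]
    exact coeff_eq_zero_of_natDegree_lt (by omega)
  have hh4 : h.natDegree ≤ 4 := by
    rw [hh, ← pow_two, natDegree_pow] at hle
    omega
  rw [← reflect_mul h h hh4 hh4, ← hh]
  ext n
  rw [coeff_reflect, coeff_reflect, revAt_invol]

theorem isSmoothPoint_affine (hsep : f.Separable) (hdeg : f.natDegree = 7 ∨ f.natDegree = 8)
    {x y : k} (h : y ^ 2 = f.eval x) : IsSmoothPoint f x y where
  not_isSquare := not_isSquare_of_separable hsep (by omega)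
  on_curve := h
  smooth := by
    rintro rfl
    exact hsep.eval₂_derivative_ne_zero (RingHom.id k) (x := x) (by
      rw [eval₂_id, ← h]
      simp)

theorem isSmoothPoint_infinity (hsep : f.Separable) (hdeg : f.natDegree = 7 ∨ f.natDegree = 8)
    {s : k} (h : s ^ 2 = f.coeff 8) : IsSmoothPoint (f.reflect 8) 0 s where
  not_isSquare := not_isSquare_reflect hsep hdeg
  on_curve := by
    rw [h, ← coeff_zero_eq_eval_zero, coeff_reflect]
    simp [revAt_le]
  smooth := by
    rintro rfl
    have h7 : f.natDegree = 7 := by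
      refine hdeg.resolve_right fun h8 => ?_
      have : f.leadingCoeff = 0 := by
        rw [leadingCoeff, h8, ← h]
        simp
      rw [leadingCoeff_eq_zero] at this
      simp [this] at h8
    rw [← coeff_zero_eq_eval_zero, coeff_derivative, coeff_reflect, revAt_le (by norm_num)]
    have : f.leadingCoeff ≠ 0 := by
      rw [Ne, leadingCoeff_eq_zero]
      rintro rfl
      simp at h7
    simpa [leadingCoeff, h7] using this

theorem rootMultiplicity_zero_reflect {u : k[X]} (hu : u ≠ 0) {N : ℕ} (hN : u.natDegree ≤ N) :
    (u.reflect N).rootMultiplicity 0 = N - u.natDegree := by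
  obtain ⟨m, rfl⟩ := Nat.exists_eq_add_of_le hN
  have h1 : u.reflect (u.natDegree + m) = u.reverse * (X - C 0) ^ m := by
    have := reflect_mul u 1 le_rfl (G := m) (by simp)
    have h0 : (1 : k[X]).reflect m = X ^ m := by simp
    rw [mul_one, h0] at this
    rw [this, reverse, C_0, sub_zero]
  have hr : u.reverse ≠ 0 := fun h => hu (reverse_eq_zero.1 h)
  rw [h1, rootMultiplicity_mul_X_sub_C_pow hr, rootMultiplicity_eq_zero, zero_add,
    Nat.add_sub_cancel_left]
  rw [IsRoot, ← coeff_zero_eq_eval_zero, coeff_zero_reverse]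
  exact leadingCoeff_ne_zero.2 hu

/-- The order of vanishing of the form `z` at a point of `C`, i.e. the multiplicity of the point
in `D_∞`. -/
noncomputable def ordZ : Point f → ℕ
  | .affine _ _ _ => 0
  | .infinity s _ => ramIndex s

variable [CharZero k]

theorem ordForm_mul (hsep : f.Separable) (hdeg : f.natDegree = 7 ∨ f.natDegree = 8) {d d' : ℕ}
    {u v u' v' : k[X]} (hu : u.natDegree ≤ d + 4) (hv : v.natDegree ≤ d)
    (hu' : u'.natDegree ≤ d' + 4) (hv' : v'.natDegree ≤ d')
    (h : u ≠ 0 ∨ v ≠ 0) (h' : u' ≠ 0 ∨ v' ≠ 0) (P : Point f) :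
    ordForm f (d + d' + 4) (u * u' + f * (v * v')) (u * v' + v * u') P =
      ordForm f d u v P + ordForm f d' u' v' P := by
  cases P with
  | affine x y hP => exact (isSmoothPoint_affine hsep hdeg hP).vanishOrder_mul h h'
  | infinity s hP =>
    have hf8 : f.natDegree ≤ 8 := by omega
    have hvv : (v * v').natDegree ≤ d + d' := natDegree_mul_le.trans (by omega)
    have h1 : (u * u' + f * (v * v')).reflect (d + d' + 4 + 4) =
        u.reflect (d + 4) * u'.reflect (d' + 4) +
          f.reflect 8 * (v.reflect d * v'.reflect d') := by
      rw [← reflect_mul v v' hv hv', ← reflect_mul f _ hf8 hvv, ← reflect_mul u u' hu hu',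
        reflect_add]
      congr 2 <;> omega
    have h2 : (u * v' + v * u').reflect (d + d' + 4) =
        u.reflect (d + 4) * v'.reflect d' + v.reflect d * u'.reflect (d' + 4) := by
      rw [← reflect_mul u v' hu hv', ← reflect_mul v u' hv hu', reflect_add]
      congr 2; omega
    simp only [ordForm]
    rw [h1, h2]
    exact (isSmoothPoint_infinity hsep hdeg hP).vanishOrder_mul
      (h.imp (reflect_ne_zero · _) (reflect_ne_zero · _))
      (h'.imp (reflect_ne_zero · _) (reflect_ne_zero · _))

omit [CharZero k] in
theorem ordForm_invol (d : ℕ) (u v : k[X]) (P : Point f) :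
    ordForm f d u (-v) P.invol = ordForm f d u v P := by
  have key : ∀ (g : k[X]) (x y : k) (u v : k[X]),
      vanishOrder g x (-y) u (-v) = vanishOrder g x y u v := by
    intro g x y u v
    have := vanishOrder_transport (RingEquiv.refl k) (ε := -1) (by norm_num) (g := g) (g' := g)
      (x₀ := x) (y₀ := y) (by simp) u v
    simpa using this
  cases P with
  | affine x y hP => exact key _ _ _ _ _
  | infinity s hP =>
    simp only [ordForm, Point.invol, reflect_neg]
    exact key _ _ _ _ _

theorem ordForm_poly_affine (hsep : f.Separable) (hdeg : f.natDegree = 7 ∨ f.natDegree = 8)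
    (d : ℕ) {u : k[X]} (hu : u ≠ 0) {x y : k} (h : y ^ 2 = f.eval x) :
    ordForm f d u 0 (.affine x y h) = ramIndex y * u.rootMultiplicity x :=
  (isSmoothPoint_affine hsep hdeg h).vanishOrder_poly hu

theorem ordForm_poly_infinity (hsep : f.Separable) (hdeg : f.natDegree = 7 ∨ f.natDegree = 8)
    {d : ℕ} {u : k[X]} (hu : u ≠ 0) (hd : u.natDegree ≤ d + 4) {s : k} (h : s ^ 2 = f.coeff 8) :
    ordForm f d u 0 (.infinity s h) = ramIndex s * (d + 4 - u.natDegree) := by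
  rw [ordForm, reflect_zero, (isSmoothPoint_infinity hsep hdeg h).vanishOrder_poly
    (reflect_ne_zero hu _), rootMultiplicity_zero_reflect hu hd]

theorem ordForm_poly_mul_y_affine (hsep : f.Separable)
    (hdeg : f.natDegree = 7 ∨ f.natDegree = 8)
    (d : ℕ) {v : k[X]} (hv : v ≠ 0) {x y : k} (h : y ^ 2 = f.eval x) :
    ordForm f d 0 v (.affine x y h) = ramIndex y * v.rootMultiplicity x + ordY y :=
  (isSmoothPoint_affine hsep hdeg h).vanishOrder_poly_mul_y hv

theorem ordForm_poly_mul_y_infinity (hsep : f.Separable)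
    (hdeg : f.natDegree = 7 ∨ f.natDegree = 8)
    {d : ℕ} {v : k[X]} (hv : v ≠ 0) (hd : v.natDegree ≤ d) {s : k} (h : s ^ 2 = f.coeff 8) :
    ordForm f d 0 v (.infinity s h) = ramIndex s * (d - v.natDegree) + ordY s := by
  rw [ordForm, reflect_zero, (isSmoothPoint_infinity hsep hdeg h).vanishOrder_poly_mul_y
    (reflect_ne_zero hv _), rootMultiplicity_zero_reflect hv hd]

theorem IsSmoothPoint.le_vanishOrder_mul_y {g u v : k[X]} {x y : k} (h : IsSmoothPoint g x y)
    (hv : v ≠ 0) {n : ℕ} (h₁ : n ≤ vanishOrder g x y u v) (h₂ : n ≤ vanishOrder g x y u (-v)) :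
    n ≤ vanishOrder g x y 0 v := by
  rw [h.le_vanishOrder_iff (by simp [hv])] at h₁ h₂ ⊢
  have h2 : elt g 0 v = elt g (C (1 / 2)) 0 * (elt g u v - elt g u (-v)) := by
    have : elt g u v - elt g u (-v) = elt g 0 (v + v) := by
      simp [elt, add_mul]
    have hv2 : C (1 / 2) * (v + v) = v := by
      rw [← two_mul, ← mul_assoc, ← map_ofNat C 2, ← C_mul]
      norm_num
    rw [this, elt_mul]
    simp only [mul_zero, zero_mul, add_zero, hv2]
  rw [h2]
  exact Ideal.mul_mem_left _ _ (sub_mem h₁ h₂)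

/-- If `u + v y` and its conjugate vanish to order `n` at `P`, so does the part `v y`. -/
theorem le_ordForm_mul_y (hsep : f.Separable) (hdeg : f.natDegree = 7 ∨ f.natDegree = 8)
    {d : ℕ} {u v : k[X]} (hv : v ≠ 0) {P : Point f} {n : ℕ} (h₁ : n ≤ ordForm f d u v P)
    (h₂ : n ≤ ordForm f d u v P.invol) : n ≤ ordForm f d 0 v P := by
  rw [← ordForm_invol, show P.invol.invol = P by cases P <;> simp [Point.invol]] at h₂
  cases P with
  | affine x y hP => exact (isSmoothPoint_affine hsep hdeg hP).le_vanishOrder_mul_y hv h₁ h₂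
  | infinity s hP =>
    simp only [ordForm, reflect_neg, reflect_zero] at h₁ h₂ ⊢
    exact (isSmoothPoint_infinity hsep hdeg hP).le_vanishOrder_mul_y (reflect_ne_zero hv _) h₁ h₂

end Forms

/-! ### Principal divisors -/

section Principal

variable {k : Type*} [Field k] {f : k[X]}

theorem cls_eq_cls_iff {D D' : Divisor f} : cls f D = cls f D' ↔ D - D' ∈ principal f := by
  rw [cls, QuotientAddGroup.mk'_apply, QuotientAddGroup.mk'_apply, QuotientAddGroup.eq_iff_sub_mem]

open Classical in
theorem pt_apply (P Q : Point f) : pt P Q = if P = Q then 1 else 0 := by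
  rw [pt, Finsupp.single_apply]

theorem ordZ_invol (P : Point f) : ordZ P.invol = ordZ P := by
  cases P with
  | affine x y h => rfl
  | infinity s h => by_cases hs : s = 0 <;> simp [Point.invol, ordZ, ramIndex, hs]

theorem Dinf_apply [CharZero k] [IsAlgClosed k] (P : Point f) : Dinf f P = ordZ P := by
  cases P with
  | affine x y h => simp [Dinf, pt_apply, Point.invol, ordZ]
  | infinity s h =>
    have hs : infRoot f = s ∨ infRoot f = -s := sq_eq_sq_iff_eq_or_eq_neg.1 (by rw [infRoot_sq, h])
    rw [Dinf, Finsupp.add_apply, pt_apply, pt_apply]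
    simp only [Point.invol, ordZ, ramIndex, Point.infinity.injEq]
    by_cases h0 : s = 0
    · have : infRoot f = 0 := by simpa [h0] using hs
      simp [h0, this]
    · have h1 : s ≠ -s := fun h => h0 (self_eq_neg.1 h)
      rcases hs with hs | hs <;> simp [hs, h0, h1.symm]

variable [CharZero k]

/-- The conjugate of the denominator clears it: a principal divisor is the divisor of a quotient
`(a + b y) / c` with `c` a form in `x` and `z`. -/
theorem IsDivOfFunction.exists_poly_denominator (hsep : f.Separable)
    (hdeg : f.natDegree = 7 ∨ f.natDegree = 8) {D : Divisor f} (hD : IsDivOfFunction f D) :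
    ∃ (d : ℕ) (a b c : k[X]), b.natDegree ≤ d ∧ c.natDegree ≤ d + 4 ∧ c ≠ 0 ∧
      ∀ P : Point f, D P = (ordForm f d a b P : ℤ) - (ordForm f d c 0 P : ℤ) := by
  obtain ⟨d, u, v, u', v', hu, hv, hu', hv', h, h', hDP⟩ := hD
  have hv'' : (-v').natDegree ≤ d := by rwa [natDegree_neg]
  have h'' : u' ≠ 0 ∨ -v' ≠ 0 := by rwa [neg_ne_zero]
  have hc : u' * u' + f * (v' * -v') = u' ^ 2 - f * v' ^ 2 := by ring
  have hc0 : u' * -v' + v' * u' = 0 := by ring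
  refine ⟨d + d + 4, u * u' + f * (v * -v'), u * -v' + v * u', u' * u' + f * (v' * -v'),
    ?_, ?_, ?_, fun P => ?_⟩
  · refine natDegree_add_le_of_degree_le (natDegree_mul_le.trans ?_) (natDegree_mul_le.trans ?_) <;>
      omega
  · refine natDegree_add_le_of_degree_le (natDegree_mul_le.trans ?_) (natDegree_mul_le.trans ?_)
    · omega
    · have : (v' * -v').natDegree ≤ d + d := natDegree_mul_le.trans (by omega)
      omega
  · rw [hc]
    exact norm_ne_zero (not_isSquare_of_separable hsep (by omega)) h'
  · have h1 := ordForm_mul hsep hdeg hu hv hu' hv'' h h'' P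
    have h2 := ordForm_mul hsep hdeg hu' hv' hu' hv'' h' h'' P
    rw [hc0] at h2
    rw [hDP, h1, h2]
    push_cast
    ring

/-- The divisors of functions already form a group, by multiplicativity of `ordForm`. -/
theorem mem_principal_iff (hsep : f.Separable) (hdeg : f.natDegree = 7 ∨ f.natDegree = 8)
    {D : Divisor f} : D ∈ principal f ↔ IsDivOfFunction f D := by
  refine ⟨fun h => ?_, fun h => AddSubgroup.subset_closure h⟩
  induction h using AddSubgroup.closure_induction with
  | mem D hD => exact hD
  | zero => exact ⟨0, 1, 0, 1, 0, by simp⟩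
  | neg D _ hD =>
    obtain ⟨d, u, v, u', v', hu, hv, hu', hv', h, h', hDP⟩ := hD
    exact ⟨d, u', v', u, v, hu', hv', hu, hv, h', h, fun P => by
      rw [Finsupp.neg_apply, hDP, neg_sub]⟩
  | add D E _ _ hD hE =>
    obtain ⟨d, u, v, u', v', hu, hv, hu', hv', h, h', hDP⟩ := hD
    obtain ⟨e, p, q, p', q', hp, hq, hp', hq', i, i', hEP⟩ := hE
    have hdom := isDomain_coordRing (not_isSquare_of_separable hsep (by omega))
    have nonzero : ∀ {u v p q : k[X]}, (u ≠ 0 ∨ v ≠ 0) → (p ≠ 0 ∨ q ≠ 0) →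
        (u * p + f * (v * q) ≠ 0 ∨ u * q + v * p ≠ 0) := by
      intro u v p q h i
      have key : ∀ {a b : k[X]}, (a ≠ 0 ∨ b ≠ 0) ↔ elt f a b ≠ 0 := by
        intro a b
        rw [Ne, Ne, Ne, elt_eq_zero_iff, not_and_or]
      rw [key, ← elt_mul]
      exact mul_ne_zero (key.1 h) (key.1 i)
    have deg₁ : ∀ {u v p q : k[X]}, u.natDegree ≤ d + 4 → v.natDegree ≤ d →
        p.natDegree ≤ e + 4 → q.natDegree ≤ e →
        (u * p + f * (v * q)).natDegree ≤ d + e + 4 + 4 := by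
      intro u v p q hu hv hp hq
      have : (v * q).natDegree ≤ d + e := natDegree_mul_le.trans (by omega)
      exact natDegree_add_le_of_degree_le (natDegree_mul_le.trans (by omega))
        (natDegree_mul_le.trans (by omega))
    have deg₂ : ∀ {u v p q : k[X]}, u.natDegree ≤ d + 4 → v.natDegree ≤ d →
        p.natDegree ≤ e + 4 → q.natDegree ≤ e →
        (u * q + v * p).natDegree ≤ d + e + 4 := by
      intro u v p q hu hv hp hq
      exact natDegree_add_le_of_degree_le (natDegree_mul_le.trans (by omega))
        (natDegree_mul_le.trans (by omega))
    refine ⟨d + e + 4, u * p + f * (v * q), u * q + v * p, u' * p' + f * (v' * q'),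
      u' * q' + v' * p', deg₁ hu hv hp hq, deg₂ hu hv hp hq, deg₁ hu' hv' hp' hq',
      deg₂ hu' hv' hp' hq', nonzero h i, nonzero h' i', fun P => ?_⟩
    rw [ordForm_mul hsep hdeg hu hv hp hq h i, ordForm_mul hsep hdeg hu' hv' hp' hq' h' i',
      Finsupp.add_apply, hDP, hEP]
    push_cast
    ring

variable [IsAlgClosed k]

/-- The divisor of the function `x - x(P)` is `(P) + (φ(P)) - D_∞`. -/
theorem pt_add_pt_invol_sub_Dinf_mem (hsep : f.Separable)
    (hdeg : f.natDegree = 7 ∨ f.natDegree = 8) {x y : k} (h : y ^ 2 = f.eval x) :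
    pt (.affine x y h) + pt (Point.invol (.affine x y h)) - Dinf f ∈ principal f := by
  classical
  refine (mem_principal_iff hsep hdeg).2 ⟨0, X - C x, 0, 1, 0, by simp, by simp, by simp, by simp,
    Or.inl (X_sub_C_ne_zero x), Or.inl one_ne_zero, fun Q => ?_⟩
  rw [Finsupp.sub_apply, Dinf_apply, Finsupp.add_apply, pt_apply, pt_apply]
  cases Q with
  | affine x' y' h' =>
    rw [ordForm_poly_affine hsep hdeg _ (X_sub_C_ne_zero x),
      ordForm_poly_affine hsep hdeg _ one_ne_zero, rootMultiplicity_X_sub_C,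
      ← C_1, rootMultiplicity_C]
    simp only [Point.invol, ordZ, Point.affine.injEq, ramIndex]
    by_cases hx : x = x'
    · subst hx
      have hs : y = y' ∨ y = -y' := sq_eq_sq_iff_eq_or_eq_neg.1 (by rw [h, h'])
      by_cases h0 : y' = 0
      · have : y = 0 := by simpa [h0] using hs
        simp [h0, this]
      · have h1 : y' ≠ -y' := fun h => h0 (self_eq_neg.1 h)
        rcases hs with rfl | rfl <;> simp [h0, h1.symm]
    · simp [hx, Ne.symm hx]
  | infinity s h' =>
    rw [ordForm_poly_infinity hsep hdeg (X_sub_C_ne_zero x) (by simp),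
      ordForm_poly_infinity hsep hdeg one_ne_zero (by simp)]
    simp only [Point.invol, ordZ, natDegree_X_sub_C, natDegree_one]
    push_cast
    simp
    ring

/-- If `(a + b y) / c` has a pole of order at most twice that of `x` at infinity, and no other
poles, then `b = 0`: at each affine point `c` divides `b` up to less than one ramification index,
so `deg c ≤ deg b`, while the weight of `y` is `4 > 2`. -/
theorem eq_zero_of_ordForm_le (hsep : f.Separable) (hdeg : f.natDegree = 7 ∨ f.natDegree = 8)
    {d : ℕ} {a b c : k[X]} (hb : b.natDegree ≤ d) (hc : c.natDegree ≤ d + 4) (hc0 : c ≠ 0)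
    (hle : ∀ P : Point f, ordForm f d c 0 P ≤ ordForm f d a b P + 2 * ordZ P) : b = 0 := by
  classical
  by_contra hb0
  have key : ∀ P : Point f, ordForm f d c 0 P ≤ ordForm f d 0 b P + 2 * ordZ P := by
    intro P
    have h1 := hle P
    have h2 := hle P.invol
    have h3 := ordForm_invol d c 0 P
    rw [neg_zero] at h3
    rw [h3, ordZ_invol] at h2
    have := le_ordForm_mul_y hsep hdeg hb0 (n := ordForm f d c 0 P - 2 * ordZ P)
      (u := a) (v := b) (P := P) (d := d) (by omega) (by omega)
    omega
  have hroots : c.roots ≤ b.roots := by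
    rw [Multiset.le_iff_count]
    intro x
    rw [count_roots, count_roots]
    obtain ⟨y, hy⟩ := IsAlgClosed.exists_pow_nat_eq (f.eval x) two_pos
    have h1 := key (.affine x y hy)
    rw [ordForm_poly_affine hsep hdeg _ hc0, ordForm_poly_mul_y_affine hsep hdeg _ hb0, ordZ,
      mul_zero, add_zero] at h1
    have h2 := ordY_lt_ramIndex y
    by_contra! hlt
    have h3 := Nat.mul_le_mul_left (ramIndex y) (Nat.succ_le_of_lt hlt)
    rw [Nat.succ_eq_add_one, mul_add, mul_one] at h3
    omega
  have hcb : c.natDegree ≤ b.natDegree := by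
    rw [(IsAlgClosed.splits c).natDegree_eq_card_roots,
      (IsAlgClosed.splits b).natDegree_eq_card_roots]
    exact Multiset.card_le_card hroots
  have h1 := key (.infinity (infRoot f) (infRoot_sq f))
  rw [ordForm_poly_infinity hsep hdeg hc0 hc, ordForm_poly_mul_y_infinity hsep hdeg hb0 hb,
    ordZ] at h1
  have h2 := ordY_lt_ramIndex (infRoot f)
  have h3 := Nat.mul_le_mul_left (ramIndex (infRoot f))
    (show d - b.natDegree + 4 ≤ d + 4 - c.natDegree by omega)
  rw [mul_add] at h3
  omega

/-- An effective divisor linearly equivalent to `2 D_∞` is invariant under the hyperelliptic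
involution, since the functions with poles at most `2 D_∞` are polynomials in `x`. -/
theorem apply_invol_of_sub_mem_principal (hsep : f.Separable)
    (hdeg : f.natDegree = 7 ∨ f.natDegree = 8) {E : Divisor f} (hE : 0 ≤ E)
    (hp : E - 2 • Dinf f ∈ principal f) (P : Point f) : E P.invol = E P := by
  obtain ⟨d, a, b, c, hb, hc, hc0, h⟩ :=
    ((mem_principal_iff hsep hdeg).1 hp).exists_poly_denominator hsep hdeg
  simp only [Finsupp.sub_apply, Finsupp.smul_apply, Dinf_apply] at h
  have hb0 : b = 0 := by
    refine eq_zero_of_ordForm_le hsep hdeg (a := a) hb hc hc0 fun P => ?_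
    have h1 := h P
    have h2 : 0 ≤ E P := hE P
    simp only [nsmul_eq_mul, Nat.cast_ofNat] at h1
    omega
  subst hb0
  have h1 := h P
  have h2 := h P.invol
  have h3 := ordForm_invol d a 0 P
  have h4 := ordForm_invol d c 0 P
  rw [neg_zero] at h3 h4
  rw [h3, h4, ordZ_invol] at h2
  linarith

/-! ### The classes `{P, P}` -/

omit [CharZero k] [IsAlgClosed k] in
theorem pt_nonneg (P : Point f) : 0 ≤ pt P := by
  classical
  intro Q
  rw [pt_apply]
  simp only [Finsupp.coe_zero, Pi.zero_apply]
  split <;> simp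

/-- The class `{P, P}` determines `P`: if `(P₁) + (P₂)` is equivalent to `2 (P)`, then
`(P₁) + (P₂) + 2 (φ(P))` is equivalent to `2 D_∞`, hence invariant under `φ`. -/
theorem eq_of_cls_eq (hsep : f.Separable) (hdeg : f.natDegree = 7 ∨ f.natDegree = 8)
    {P P₁ P₂ : Point f} (hP : P.IsAffineNonWeierstrass)
    (h : cls f (pt P₁ + pt P₂ - Dinf f) = cls f (2 • pt P - Dinf f)) : P₁ = P ∧ P₂ = P := by
  classical
  cases P with
  | infinity s hs => exact hP.elim
  | affine x y hxy =>
    have hy : y ≠ 0 := hP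
    set P : Point f := .affine x y hxy
    have hne : P ≠ P.invol := by
      simp only [P, Point.invol, ne_eq, Point.affine.injEq, true_and]
      exact fun h => hy (self_eq_neg.1 h)
    have h1 := add_mem (cls_eq_cls_iff.1 h)
      (nsmul_mem (pt_add_pt_invol_sub_Dinf_mem hsep hdeg hxy) 2)
    have h2 := apply_invol_of_sub_mem_principal hsep hdeg (E := pt P₁ + pt P₂ + 2 • pt P.invol)
      (add_nonneg (add_nonneg (pt_nonneg _) (pt_nonneg _)) (nsmul_nonneg (pt_nonneg _) 2)) (by
        convert h1 using 1
        abel) P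
    simp only [Finsupp.add_apply, Finsupp.smul_apply, pt_apply, if_neg hne.symm, if_true] at h2
    by_cases h3 : P₁ = P <;> by_cases h4 : P₂ = P
    · exact ⟨h3, h4⟩
    all_goals
      exfalso
      simp only [h3, h4, if_true, if_false] at h2
      split_ifs at h2 <;> simp at h2

theorem lam_ne_zero (hsep : f.Separable) (hdeg : f.natDegree = 7 ∨ f.natDegree = 8)
    {P : Point f} (hP : P.IsAffineNonWeierstrass) : lam P ≠ 0 := by
  classical
  cases P with
  | infinity s hs => exact hP.elim
  | affine x y hxy =>
    have hy : y ≠ 0 := hP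
    set P : Point f := .affine x y hxy
    have hne : P ≠ P.invol := by
      simp only [P, Point.invol, ne_eq, Point.affine.injEq, true_and]
      exact fun h => hy (self_eq_neg.1 h)
    intro h0
    have h0' : cls f (2 • pt P - Dinf f) = cls f 0 := by
      rw [map_zero]
      exact congrArg Subtype.val h0
    have h1 := add_mem (cls_eq_cls_iff.1 h0') (pt_add_pt_invol_sub_Dinf_mem hsep hdeg hxy)
    have h2 := apply_invol_of_sub_mem_principal hsep hdeg (E := 3 • pt P + pt P.invol)
      (add_nonneg (nsmul_nonneg (pt_nonneg _) 3) (pt_nonneg _)) (by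
        convert h1 using 1
        abel) P
    simp [pt_apply, hne, hne.symm] at h2

theorem lam_invol (hsep : f.Separable) (hdeg : f.natDegree = 7 ∨ f.natDegree = 8)
    {P : Point f} (hP : P.IsAffineNonWeierstrass) : lam P.invol = -lam P := by
  cases P with
  | infinity s hs => exact hP.elim
  | affine x y hxy =>
    apply Subtype.ext
    change cls f (2 • pt _ - Dinf f) = -cls f (2 • pt _ - Dinf f)
    rw [← map_neg, cls_eq_cls_iff]
    convert nsmul_mem (pt_add_pt_invol_sub_Dinf_mem hsep hdeg hxy) 2 using 1
    abel

end Principal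

/-! ### Fibres of the Kummer map -/

section KummerFibre

variable {k : Type*} [Field k] {f : k[X]}

theorem thetaVec_self_ne_zero {P : Point f} (hP : P.IsAffineNonWeierstrass) :
    thetaVec P P ≠ 0 := by
  cases P with
  | infinity s hs => exact hP.elim
  | affine x y hxy =>
    intro h
    simpa [thetaVec, Point.zc] using congrFun h 1

theorem thetaVec_invol (P : Point f) : thetaVec P.invol P.invol = thetaVec P P := by
  cases P <;> simp [thetaVec, sigmaEight, diagS0, Point.invol, Point.xc, Point.yc, Point.zc]

theorem Point.IsAffineNonWeierstrass.invol {P : Point f} (hP : P.IsAffineNonWeierstrass) :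
    P.invol.IsAffineNonWeierstrass := by
  cases P with
  | infinity s hs => exact hP.elim
  | affine x y hxy => exact neg_ne_zero.2 hP

/-- A multiple of `thetaVec P P` with `P` affine satisfies the discriminant condition. -/
theorem coords_of_smul_thetaVec {P : Point f} (hP : P.IsAffineNonWeierstrass) {v : Fin 8 → k}
    (hv : v ≠ 0) {c : k} (h : c • thetaVec P P = v) :
    v 1 ≠ 0 ∧ v 2 ^ 2 - 4 * v 1 * v 3 = 0 := by
  have hc : c ≠ 0 := by
    rintro rfl
    exact hv (by rw [← h, zero_smul])
  subst h
  cases P with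
  | infinity s hs => exact hP.elim
  | affine x y hxy =>
    refine ⟨by simpa [thetaVec, Point.zc] using hc, ?_⟩
    simp [thetaVec, Point.zc, Point.xc]
    ring

variable [CharZero k]

theorem isGeneralPosition_two {P : Point f} (hP : P.IsAffineNonWeierstrass) :
    IsGeneralPosition (pt P + pt P) := by
  classical
  refine ⟨add_nonneg (pt_nonneg P) (pt_nonneg P), fun Q hQ => ?_⟩
  cases P with
  | infinity s hs => exact hP.elim
  | affine x y hxy =>
    have hy : y ≠ 0 := hP
    have h1 := hQ Q
    have h2 := hQ Q.invol
    simp only [Finsupp.add_apply, pt_apply, if_true] at h1 h2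
    have hQ1 : Point.affine x y hxy = Q := by
      by_contra hne
      rw [if_neg hne] at h1
      split_ifs at h1 <;> simp at h1
    have hQ2 : Point.affine x y hxy = Q.invol := by
      by_contra hne
      rw [if_neg hne] at h2
      split_ifs at h2 <;> simp at h2
    rw [← hQ1] at hQ2
    simp only [Point.invol, Point.affine.injEq, true_and] at hQ2
    exact hy (self_eq_neg.1 hQ2)

variable [IsAlgClosed k]

/-- The choice in the definition of `κ` is harmless at `{P, P}`, as the class determines `P`. -/
theorem kappa_lam (hsep : f.Separable) (hdeg : f.natDegree = 7 ∨ f.natDegree = 8)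
    {P : Point f} (hP : P.IsAffineNonWeierstrass) :
    kappa f (lam P) = Projectivization.mk k (thetaVec P P) (thetaVec_self_ne_zero hP) := by
  have hex : ∃ R, IsThetaImage (lam P) R :=
    ⟨_, P, P, isGeneralPosition_two hP, by rw [← two_nsmul]; rfl, thetaVec_self_ne_zero hP, rfl⟩
  rw [kappa, if_neg (lam_ne_zero hsep hdeg hP), dif_pos hex]
  obtain ⟨P₁, P₂, -, hcls, hv, hR⟩ := hex.choose_spec
  obtain ⟨rfl, rfl⟩ := eq_of_cls_eq hsep hdeg hP hcls.symm
  exact hR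

/-- A class whose image under `κ` has first coordinate zero, second coordinate nonzero and
vanishing discriminant is of the form `{P, P}`: the conditions say that the two points of the
representing divisor are affine and have the same `x`-coordinate. -/
theorem exists_eq_lam_of_kappa_eq {Q : Jac f} {v : Fin 8 → k} (hv : v ≠ 0)
    (hQ : kappa f Q = Projectivization.mk k v hv) (h0 : v 0 = 0) (h1 : v 1 ≠ 0)
    (hdisc : v 2 ^ 2 - 4 * v 1 * v 3 = 0) :
    ∃ P : Point f, P.IsAffineNonWeierstrass ∧ Q = lam P := by
  classical
  have horigin : Projectivization.mk k originVec originVec_ne_zero ≠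
      Projectivization.mk k v hv := by
    intro h
    obtain ⟨c, hc⟩ := (Projectivization.mk_eq_mk_iff' k _ _ _ _).1 h.symm
    apply h1
    rw [← hc]
    simp [originVec]
  rw [kappa] at hQ
  split_ifs at hQ with hz hth hgen
  · exact (horigin hQ).elim
  · obtain ⟨P₁, P₂, hgp, hcls, hw, hR⟩ := hth.choose_spec
    rw [hR] at hQ
    obtain ⟨c, rfl⟩ := (Projectivization.mk_eq_mk_iff' k _ _ _ _).1 hQ.symm
    cases P₁ with
    | infinity s hs => simp [thetaVec, Point.zc] at h1
    | affine x y hxy =>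
      cases P₂ with
      | infinity s hs => simp [thetaVec, Point.zc] at h1
      | affine x' y' hxy' =>
        simp only [thetaVec, Point.zc, Point.xc, Pi.smul_apply, smul_eq_mul] at h1 hdisc
        simp at h1 hdisc
        have hxx : x = x' := by
          have : c ^ 2 * (x - x') ^ 2 = 0 := by linear_combination hdisc
          simpa [h1, sub_eq_zero] using this
        subst hxx
        have hne : y' ≠ -y := by
          rintro rfl
          exact hgp.2 (.affine x y hxy) le_rfl
        have hyy : y' = y := (sq_eq_sq_iff_eq_or_eq_neg.1 (by rw [hxy, hxy'])).resolve_right hne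
        subst hyy
        refine ⟨.affine x y' hxy, fun h => hne (by simp [h]), Subtype.ext ?_⟩
        rw [hcls, ← two_nsmul]
        rfl
  · obtain ⟨D, a, b, c, -, -, -, -, -, -, -, -, hw, hR⟩ := hgen.choose_spec
    rw [hR] at hQ
    obtain ⟨t, ht⟩ := (Projectivization.mk_eq_mk_iff' k _ _ _ _).1 hQ
    have := congrFun ht 0
    simp [genericVec, h0] at this
  · exact (horigin hQ).elim

theorem kappa_preimage_thetaVec (hsep : f.Separable) (hdeg : f.natDegree = 7 ∨ f.natDegree = 8)
    {P : Point f} (hP : P.IsAffineNonWeierstrass) :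
    kappa f ⁻¹' {Projectivization.mk k (thetaVec P P) (thetaVec_self_ne_zero hP)} =
      {lam P, -lam P} := by
  ext Q
  simp only [Set.mem_preimage, Set.mem_singleton_iff, Set.mem_insert_iff]
  constructor
  · intro hQ
    obtain ⟨h1, h2⟩ := coords_of_smul_thetaVec hP (thetaVec_self_ne_zero hP) (one_smul k _)
    obtain ⟨P', hP', rfl⟩ := exists_eq_lam_of_kappa_eq _ hQ (by simp [thetaVec]) h1 h2
    rw [kappa_lam hsep hdeg hP'] at hQ
    obtain ⟨c, hc⟩ := (Projectivization.mk_eq_mk_iff' k _ _ _ _).1 hQ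
    rw [← lam_invol hsep hdeg hP]
    cases P with
    | infinity s hs => exact hP.elim
    | affine x y hxy =>
      cases P' with
      | infinity s hs => exact hP'.elim
      | affine x' y' hxy' =>
        have e1 := congrFun hc 1
        have e2 := congrFun hc 2
        simp [thetaVec, Point.zc, Point.xc] at e1 e2
        have hxx : x = x' := by
          rw [e1, one_mul] at e2
          have : 2 * (x - x') = 0 := by linear_combination -e2
          simpa [sub_eq_zero] using this
        subst hxx
        rcases sq_eq_sq_iff_eq_or_eq_neg.1 (hxy'.trans hxy.symm) with rfl | rfl
        · exact Or.inl rfl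
        · exact Or.inr rfl
  · rintro (rfl | rfl)
    · exact kappa_lam hsep hdeg hP
    · rw [← lam_invol hsep hdeg hP, kappa_lam hsep hdeg hP.invol]
      congr 1
      exact thetaVec_invol P

end KummerFibre

/-! ### The Galois action -/

section Galois

variable {f : ℚ[X]}

theorem bar_map (f : ℚ[X]) (τ : Qbar ≃ₐ[ℚ] Qbar) :
    (bar f).map ((τ : Qbar ≃+* Qbar) : Qbar →+* Qbar) = bar f := by
  rw [map_map]
  congr 1
  ext r
  exact τ.commutes r

theorem galPoint_symm_galPoint (τ : Qbar ≃ₐ[ℚ] Qbar) (P : Point (bar f)) :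
    galPoint τ.symm (galPoint τ P) = P := by
  cases P <;> simp [galPoint]

theorem galPoint_galPoint_symm (τ : Qbar ≃ₐ[ℚ] Qbar) (P : Point (bar f)) :
    galPoint τ (galPoint τ.symm P) = P :=
  galPoint_symm_galPoint τ.symm P

theorem galDivisor_apply_galPoint (τ : Qbar ≃ₐ[ℚ] Qbar) (D : Divisor (bar f))
    (P : Point (bar f)) : galDivisor τ D (galPoint τ P) = D P :=
  Finsupp.mapDomain_apply (Function.LeftInverse.injective (galPoint_symm_galPoint τ)) D P

theorem galDivisor_sub (τ : Qbar ≃ₐ[ℚ] Qbar) (D D' : Divisor (bar f)) :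
    galDivisor τ (D - D') = galDivisor τ D - galDivisor τ D' :=
  map_sub (Finsupp.mapDomain.addMonoidHom (galPoint τ)) D D'

theorem galDivisor_two_pt (τ : Qbar ≃ₐ[ℚ] Qbar) (P : Point (bar f)) :
    galDivisor τ (2 • pt P) = 2 • pt (galPoint τ P) := by
  rw [galDivisor, Finsupp.mapDomain_smul, pt, Finsupp.mapDomain_single]
  rfl

theorem galDivisor_Dinf (τ : Qbar ≃ₐ[ℚ] Qbar) : galDivisor τ (Dinf (bar f)) = Dinf (bar f) := by
  ext P
  rw [← galPoint_galPoint_symm τ P, galDivisor_apply_galPoint, Dinf_apply, Dinf_apply]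
  generalize galPoint τ.symm P = Q
  cases Q with
  | affine x y h => rfl
  | infinity s h => by_cases hs : s = 0 <;> simp [galPoint, ordZ, ramIndex, hs]

theorem ordForm_galPoint (τ : Qbar ≃ₐ[ℚ] Qbar) (d : ℕ) (u v : Qbar[X]) (P : Point (bar f)) :
    ordForm (bar f) d (u.map ((τ : Qbar ≃+* Qbar) : Qbar →+* Qbar))
      (v.map ((τ : Qbar ≃+* Qbar) : Qbar →+* Qbar)) (galPoint τ P) = ordForm (bar f) d u v P := by
  cases P with
  | affine x y h =>
    have := vanishOrder_transport (τ : Qbar ≃+* Qbar) (ε := 1) (one_pow 2) (bar_map f τ)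
      (x₀ := x) (y₀ := y) u v
    simpa [ordForm, galPoint] using this
  | infinity s h =>
    have := vanishOrder_transport (τ : Qbar ≃+* Qbar) (ε := 1) (one_pow 2)
      (g := (bar f).reflect 8) (g' := (bar f).reflect 8) (by rw [← reflect_map, bar_map])
      (x₀ := 0) (y₀ := s) (u.reflect (d + 4)) (v.reflect d)
    simpa [ordForm, galPoint, reflect_map] using this

theorem galDivisor_mem_principal (hsep : (bar f).Separable)
    (hdeg : (bar f).natDegree = 7 ∨ (bar f).natDegree = 8) (τ : Qbar ≃ₐ[ℚ] Qbar)
    {D : Divisor (bar f)} (hD : D ∈ principal (bar f)) : galDivisor τ D ∈ principal (bar f) := by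
  rw [mem_principal_iff hsep hdeg] at hD ⊢
  obtain ⟨d, u, v, u', v', hu, hv, hu', hv', h, h', hDP⟩ := hD
  have hinj : Function.Injective ((τ : Qbar ≃+* Qbar) : Qbar →+* Qbar) := τ.injective
  have hne : ∀ {p : Qbar[X]}, p ≠ 0 → p.map ((τ : Qbar ≃+* Qbar) : Qbar →+* Qbar) ≠ 0 :=
    fun hp => (Polynomial.map_ne_zero_iff hinj).2 hp
  refine ⟨d, u.map _, v.map _, u'.map _, v'.map _, natDegree_map_le.trans hu,
    natDegree_map_le.trans hv, natDegree_map_le.trans hu', natDegree_map_le.trans hv',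
    h.imp hne hne, h'.imp hne hne, fun P => ?_⟩
  rw [← galPoint_galPoint_symm τ P, galDivisor_apply_galPoint, hDP, ordForm_galPoint,
    ordForm_galPoint]

/-- The `ℚ`-algebra structure coming from characteristic zero is the one of the algebraic closure,
because `ℚ`-algebra structures are unique. -/
theorem isGalois_Qbar : IsGalois ℚ Qbar := by
  have h : @IsGalois ℚ _ (AlgebraicClosure ℚ) _ (AlgebraicClosure.instAlgebra ℚ) :=
    IsAlgClosure.isGalois ..
  convert h
  exact Subsingleton.elim _ _

/-- If the class `{P, P}` is Galois-invariant, then so is `P`, since the class determines `P`. -/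
theorem isRationalPoint_of_lam_mem_rationalJac (hsep : (bar f).Separable)
    (hdeg : (bar f).natDegree = 7 ∨ (bar f).natDegree = 8) {P : Point (bar f)}
    (hP : P.IsAffineNonWeierstrass) (h : lam P ∈ rationalJac f) : IsRationalPoint P := by
  obtain ⟨D, hD, hτ⟩ := h
  change cls (bar f) D = cls (bar f) (2 • pt P - Dinf (bar f)) at hD
  have hfix : ∀ τ : Qbar ≃ₐ[ℚ] Qbar, galPoint τ P = P := by
    intro τ
    have h1 := galDivisor_mem_principal hsep hdeg τ (cls_eq_cls_iff.1 hD)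
    rw [galDivisor_sub, galDivisor_sub, galDivisor_Dinf, galDivisor_two_pt,
      ← cls_eq_cls_iff, hτ, two_nsmul] at h1
    exact (eq_of_cls_eq hsep hdeg hP h1.symm).1
  cases P with
  | infinity s hs => exact hP.elim
  | affine x y hxy =>
    simp only [galPoint, Point.affine.injEq] at hfix
    have : IsGalois ℚ Qbar := isGalois_Qbar
    exact ⟨(InfiniteGalois.mem_range_algebraMap_iff_fixed x).2 fun τ => (hfix τ).1,
      (InfiniteGalois.mem_range_algebraMap_iff_fixed y).2 fun τ => (hfix τ).2⟩

theorem lam_mem_rationalJac {P : Point (bar f)} (hP : IsRationalPoint P) :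
    lam P ∈ rationalJac f := by
  refine ⟨2 • pt P - Dinf (bar f), rfl, fun τ => ?_⟩
  have hfix : galPoint τ P = P := by
    cases P with
    | affine x y hxy =>
      obtain ⟨⟨a, rfl⟩, b, rfl⟩ := hP
      simp [galPoint]
    | infinity s hs =>
      obtain ⟨b, rfl⟩ := hP
      simp [galPoint]
  rw [galDivisor_sub, galDivisor_Dinf, galDivisor_two_pt, hfix]
  rfl

end Galois

end HypGenusThree

theorem corollary3p2 (f : Polynomial ℚ) (hsq : Squarefree f)
    (hdeg : f.natDegree = 7 ∨ f.natDegree = 8)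
    (σ : Fin 8 → ℚ) (hσ : σ ≠ 0) (hσ₁ : σ 0 = 0)
    (hK : HypGenusThree.ratPoint σ hσ ∈ HypGenusThree.Kummer (HypGenusThree.bar f)) :
    ((∃ P : HypGenusThree.Point (HypGenusThree.bar f), P.IsAffineNonWeierstrass ∧
        HypGenusThree.kappa (HypGenusThree.bar f) ⁻¹' {HypGenusThree.ratPoint σ hσ} =
          {HypGenusThree.lam P, -HypGenusThree.lam P}) ↔
      (σ 1 ≠ 0 ∧ σ 2 ^ 2 - 4 * σ 1 * σ 3 = 0)) ∧
    ((∃ P : HypGenusThree.Point (HypGenusThree.bar f), HypGenusThree.IsRationalPoint P ∧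
        P.IsAffineNonWeierstrass ∧
        HypGenusThree.kappa (HypGenusThree.bar f) ⁻¹' {HypGenusThree.ratPoint σ hσ} =
          {HypGenusThree.lam P, -HypGenusThree.lam P}) ↔
      (HypGenusThree.ratPoint σ hσ ∈
          HypGenusThree.kappa (HypGenusThree.bar f) '' HypGenusThree.rationalJac f ∧
        σ 1 ≠ 0 ∧ σ 2 ^ 2 - 4 * σ 1 * σ 3 = 0)) := by
  open HypGenusThree in
  have hsep : (bar f).Separable := (PerfectField.separable_iff_squarefree.2 hsq).map
  have hdeg' : (bar f).natDegree = 7 ∨ (bar f).natDegree = 8 := by rwa [natDegree_map]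
  -- The conditions on `σ` are those on its image in `Qbar`.
  have hcond : ∀ P : Point (bar f), P.IsAffineNonWeierstrass →
      kappa (bar f) (lam P) = ratPoint σ hσ → σ 1 ≠ 0 ∧ σ 2 ^ 2 - 4 * σ 1 * σ 3 = 0 := by
    intro P hP h
    rw [kappa_lam hsep hdeg' hP] at h
    obtain ⟨c, hc⟩ := (Projectivization.mk_eq_mk_iff' Qbar _ _ _ _).1 h.symm
    obtain ⟨h1, h2⟩ := coords_of_smul_thetaVec hP (fun h => hσ (funext fun i =>
      (map_eq_zero (algebraMap ℚ Qbar)).1 (congrFun h i))) hc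
    refine ⟨fun h => h1 (by rw [h, map_zero]), ?_⟩
    apply (algebraMap ℚ Qbar).injective
    simpa using h2
  have hlam : ∀ Q : Jac (bar f), kappa (bar f) Q = ratPoint σ hσ → σ 1 ≠ 0 →
      σ 2 ^ 2 - 4 * σ 1 * σ 3 = 0 → ∃ P : Point (bar f), P.IsAffineNonWeierstrass ∧ Q = lam P := by
    intro Q hQ h1 h2
    refine exists_eq_lam_of_kappa_eq _ hQ (by rw [hσ₁, map_zero]) (by simpa using h1) ?_
    have := congrArg (algebraMap ℚ Qbar) h2
    simpa using this
  have hfib : ∀ P : Point (bar f), P.IsAffineNonWeierstrass →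
      kappa (bar f) (lam P) = ratPoint σ hσ →
      kappa (bar f) ⁻¹' {ratPoint σ hσ} = {lam P, -lam P} := by
    intro P hP h
    rw [← h, kappa_lam hsep hdeg' hP]
    exact kappa_preimage_thetaVec hsep hdeg' hP
  have hmem : ∀ P : Point (bar f), kappa (bar f) ⁻¹' {ratPoint σ hσ} = {lam P, -lam P} →
      kappa (bar f) (lam P) = ratPoint σ hσ := by
    intro P h
    have : lam P ∈ kappa (bar f) ⁻¹' {ratPoint σ hσ} := by
      rw [h]
      exact Set.mem_insert _ _
    exact this
  refine ⟨⟨?_, ?_⟩, ?_, ?_⟩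
  · rintro ⟨P, hP, h⟩
    exact hcond P hP (hmem P h)
  · rintro ⟨h1, h2⟩
    obtain ⟨Q, hQ⟩ := hK
    obtain ⟨P, hP, rfl⟩ := hlam Q hQ h1 h2
    exact ⟨P, hP, hfib P hP hQ⟩
  · rintro ⟨P, hrat, hP, h⟩
    exact ⟨⟨lam P, lam_mem_rationalJac hrat, hmem P h⟩, hcond P hP (hmem P h)⟩
  · rintro ⟨⟨Q, hQrat, hQ⟩, h1, h2⟩
    obtain ⟨P, hP, rfl⟩ := hlam Q hQ h1 h2
    exact ⟨P, isRationalPoint_of_lam_mem_rationalJac hsep hdeg' hP hQrat, hP, hfib P hP hQ⟩
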